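/- Let $d\ge 0$ and $n\ge 0$ be integers, and let $a,b:\mathbb R^{2d}\to\mathbb R$ be Schwartz functions. For $\varepsilon>0$ and a Schwartz function $c:\mathbb R^{2d}\to\mathbb C$ let ${\rm op}^{\rm We}(c)$ be the Weyl quantization, the bounded operator on $L^2(\mathbb R^d)$ given by $$({\rm op}^{\rm We}(c)\psi)(q)=(2\pi\varepsilon)^{-d}\int_{\mathbb R^d}\int_{\mathbb R^d} c\big(\tfrac{q+y}{2},p\big)\,e^{i(q-y)\cdot p/\varepsilon}\,\psi(y)\,dp\,dy ,$$ and let ${\rm op}^{\rm AW}(c)={\rm op}^{\rm We}(c*G_{\varepsilon/2})$ be the Anti-Wick quantization, where $G_{\varepsilon/2}(z)=(\pi\varepsilon)^{-d}e^{-|z|^2/\varepsilon}$ for $z\in\mathbb R^{2d}$. Then there is a family of Schwartz functions $\gamma_n^\varepsilon=\gamma_n^\varepsilon(a,b):\mathbb R^{2d}\to\mathbb C$, $\varepsilon>0$, with $$\sup_{\varepsilon>0}\big\|{\rm op}^{\rm We}(\gamma_n^\varepsilon)\big\|_{\mathcal L(L^2(\mathbb R^d))}<\infty ,$$ such that for all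 $\varepsilon>0$ $${\rm op}^{\rm AW}(a)\,{\rm op}^{\rm AW}(b)={\rm op}^{\rm AW}\Big(ab+\sum_{m=1}^{n}\varepsilon^m\lambda_m(a,b)\Big)+\varepsilon^{n+1}\,{\rm op}^{\rm We}(\gamma_n^\varepsilon),$$ where $$\lambda_m(a,b)(z)=\frac{(-1)^m}{2^m m!}\Big[\big((\nabla_z,\nabla_w)+i\,(J\nabla_z,\nabla_w)\big)^m\big(a(z)\,b(w)\big)\Big]_{w=z},\qquad J=\begin{pmatrix}0&{\rm Id}\\-{\rm Id}&0\end{pmatrix}.$$ Here, with $z=(q,p)$ and $w=(q',p')$, $(\nabla_z,\nabla_w)=\sum_{j=1}^d(\partial_{q_j}\partial_{q'_j}+\partial_{p_j}\partial_{p'_j})$ and $(J\nabla_z,\nabla_w)=\sum_{j=1}^d(\partial_{p_j}\partial_{q'_j}-\partial_{q_j}\partial_{p'_j})$. -/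

import Mathlib

open scoped SchwartzMap LineDeriv
open MeasureTheory

noncomputable section

namespace AntiWick

/-- Configuration space `ℝ^d` with the Euclidean norm. -/
abbrev Config (d : ℕ) : Type := EuclideanSpace ℝ (Fin d)

/-- Phase space `ℝ^{2d}` with its Euclidean norm; its points are `z = (q, p)`. -/
abbrev Phase (d : ℕ) : Type := WithLp 2 (Config d × Config d)

/-- The point `(q, p)` of phase space. -/
abbrev pt {d : ℕ} (q p : Config d) : Phase d := WithLp.toLp 2 (q, p)

/-- The Hilbert space `L²(ℝ^d)` of complex-valued square integrable functions. -/
abbrev L2 (d : ℕ) : Type := Lp ℂ 2 (volume : Measure (Config d))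

/-- A real-valued Schwartz function, regarded as a complex-valued one. -/
def toComplex {d : ℕ} (a : 𝓢(Phase d, ℝ)) : 𝓢(Phase d, ℂ) :=
  SchwartzMap.postcompCLM (𝕜 := ℝ) Complex.ofRealCLM a

theorem toComplex_apply {d : ℕ} (a : 𝓢(Phase d, ℝ)) (z : Phase d) :
    toComplex a z = (a z : ℂ) := rfl

/-- The pointwise product `a b` of two Schwartz functions. -/
def mulS {d : ℕ} (a b : 𝓢(Phase d, ℂ)) : 𝓢(Phase d, ℂ) :=
  SchwartzMap.pairing (ContinuousLinearMap.mul ℂ ℂ) a b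

theorem mulS_apply {d : ℕ} (a b : 𝓢(Phase d, ℂ)) (z : Phase d) :
    mulS a b z = a z * b z := rfl

/-! ### Weyl quantization -/

/-- `(op^We(a) ψ)(q) = (2πε)^{-d} ∫∫ a((q+y)/2, p) e^{i (q-y)·p/ε} ψ(y) dp dy`. -/
def weylFun {d : ℕ} (ε : ℝ) (a : 𝓢(Phase d, ℂ)) (ψ : Config d → ℂ) (q : Config d) : ℂ :=
  (((2 * Real.pi * ε) ^ d)⁻¹ : ℝ) * ∫ y : Config d, ∫ p : Config d,
    a (pt ((2 : ℝ)⁻¹ • (q + y)) p) *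
      Complex.exp (Complex.I * ((inner ℝ (q - y) p / ε : ℝ) : ℂ)) * ψ y

/-- The integral kernel of `weylFun`, without the factor `(2πε)^{-d}`. -/
def weylKer {d : ℕ} (ε : ℝ) (a : 𝓢(Phase d, ℂ)) (q y : Config d) : ℂ :=
  ∫ p : Config d, a (pt ((2 : ℝ)⁻¹ • (q + y)) p) *
      Complex.exp (Complex.I * ((inner ℝ (q - y) p / ε : ℝ) : ℂ))

theorem weylFun_eq {d : ℕ} (ε : ℝ) (a : 𝓢(Phase d, ℂ)) (ψ : Config d → ℂ) (q : Config d) :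
    weylFun ε a ψ q =
      (((2 * Real.pi * ε) ^ d)⁻¹ : ℝ) * ∫ y : Config d, weylKer ε a q y * ψ y := by
  simp only [weylFun, weylKer, integral_mul_const]

/-- The symbol restricted to fixed position `x` is smooth in the momentum `p`. -/
theorem slice_contDiff {d : ℕ} (a : 𝓢(Phase d, ℂ)) (x : Config d) :
    ContDiff ℝ (⊤ : ℕ∞) (fun p => a (pt x p)) :=
  (a.smooth ⊤).comp <|
    (WithLp.prodContinuousLinearEquiv 2 ℝ (Config d) (Config d)).symm.contDiff.comp
      (contDiff_const.prodMk contDiff_id)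

theorem slice_bound {d : ℕ} (a : 𝓢(Phase d, ℂ)) (m k n : ℕ) :
    ∃ C, ∀ x p : Config d,
      ‖x‖ ^ m * (‖p‖ ^ k * ‖iteratedFDeriv ℝ n (fun p => a (pt x p)) p‖) ≤ C := by
  let L : Config d →L[ℝ] Phase d :=
    (WithLp.prodContinuousLinearEquiv 2 ℝ (Config d) (Config d)).symm.toContinuousLinearMap ∘L
      ContinuousLinearMap.inr ℝ (Config d) (Config d)
  obtain ⟨C, -, hC⟩ := a.decay (m + k) n
  refine ⟨C * ‖L‖ ^ n, fun x p => ?_⟩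
  have h1 : (fun p => a (pt x p)) = (fun z => a (z + pt x 0)) ∘ L := by
    funext p
    simp only [Function.comp, L]
    congr 1
    refine WithLp.ofLp_injective 2 ?_
    simp
  have hx : ‖x‖ ≤ ‖pt x p‖ := by
    rw [WithLp.prod_norm_eq_of_L2]
    exact Real.le_sqrt_of_sq_le (by simp)
  have hp : ‖p‖ ≤ ‖pt x p‖ := by
    rw [WithLp.prod_norm_eq_of_L2]
    exact Real.le_sqrt_of_sq_le (by simp)
  have hz : L p + pt x 0 = pt x p := by
    refine WithLp.ofLp_injective 2 ?_
    simp [L]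
  have h2 : ‖iteratedFDeriv ℝ n (fun p => a (pt x p)) p‖ ≤
      ‖iteratedFDeriv ℝ n a (pt x p)‖ * ‖L‖ ^ n := by
    rw [h1, L.iteratedFDeriv_comp_right (n := (⊤ : ℕ∞)) _ _ (by exact_mod_cast le_top),
      iteratedFDeriv_comp_add_right]
    · refine (ContinuousMultilinearMap.norm_compContinuousLinearMap_le _ _).trans ?_
      simp [hz]
    · exact (a.smooth ⊤).comp (contDiff_id.add contDiff_const)
  calc ‖x‖ ^ m * (‖p‖ ^ k * ‖iteratedFDeriv ℝ n (fun p => a (pt x p)) p‖)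
      ≤ ‖pt x p‖ ^ m * (‖pt x p‖ ^ k * (‖iteratedFDeriv ℝ n a (pt x p)‖ * ‖L‖ ^ n)) := by
        gcongr
    _ = (‖pt x p‖ ^ (m + k) * ‖iteratedFDeriv ℝ n a (pt x p)‖) * ‖L‖ ^ n := by
        rw [pow_add]; ring
    _ ≤ C * ‖L‖ ^ n := by gcongr; exact hC _

/-- The slice `p ↦ a(x, p)` of a Schwartz function. -/
def slice {d : ℕ} (a : 𝓢(Phase d, ℂ)) (x : Config d) : 𝓢(Config d, ℂ) where
  toFun p := a (pt x p)
  smooth' := slice_contDiff a x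
  decay' k n := by
    obtain ⟨C, hC⟩ := slice_bound a 0 k n
    exact ⟨C, fun p => by simpa using hC x p⟩

theorem slice_fourier_decay {d : ℕ} (a : 𝓢(Phase d, ℂ)) (m k : ℕ) :
    ∃ C, 0 ≤ C ∧ ∀ x w : Config d,
      ‖x‖ ^ m * ‖w‖ ^ k * ‖FourierTransform.fourier (slice a x) w‖ ≤ C := by
  have hcont : Continuous ((SchwartzMap.seminorm ℂ k 0).comp
      (FourierTransform.fourierCLM ℂ 𝓢(Config d, ℂ)).toLinearMap) :=
    ((schwartz_withSeminorms ℂ (Config d) ℂ).continuous_seminorm (k, 0)).comp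
      (FourierTransform.fourierCLM ℂ 𝓢(Config d, ℂ)).continuous
  obtain ⟨s, K, -, hK⟩ := Seminorm.bound_of_continuous
    (schwartz_withSeminorms ℂ (Config d) ℂ) _ hcont
  choose B hB using fun i : ℕ × ℕ => slice_bound a m i.1 i.2
  have hB0 : ∀ i, 0 ≤ B i := fun i => le_trans (by positivity) (hB i 0 0)
  refine ⟨K * ∑ i ∈ s, B i, mul_nonneg K.2 (Finset.sum_nonneg fun i _ => hB0 i),
    fun x w => ?_⟩
  have h1 : ‖w‖ ^ k * ‖FourierTransform.fourier (slice a x) w‖ ≤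
      K * (s.sup (schwartzSeminormFamily ℂ (Config d) ℂ)) (slice a x) := by
    refine le_trans ?_ (hK (slice a x))
    exact SchwartzMap.norm_pow_mul_le_seminorm ℂ (FourierTransform.fourier (slice a x)) k w
  have h2 : (s.sup (schwartzSeminormFamily ℂ (Config d) ℂ)) (slice a x) ≤
      ∑ i ∈ s, SchwartzMap.seminorm ℂ i.1 i.2 (slice a x) := by
    have := Seminorm.finset_sup_le_sum (schwartzSeminormFamily ℂ (Config d) ℂ) s
    refine (this (slice a x)).trans (le_of_eq ?_)
    simp [schwartzSeminormFamily]
  have h3 : ∀ i : ℕ × ℕ, ‖x‖ ^ m * SchwartzMap.seminorm ℂ i.1 i.2 (slice a x) ≤ B i := by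
    intro i
    have : SchwartzMap.seminorm ℂ i.1 i.2 ((‖x‖ ^ m : ℝ) • slice a x) ≤ B i := by
      refine SchwartzMap.seminorm_le_bound ℂ i.1 i.2 _ (hB0 i) fun p => ?_
      have e : (((‖x‖ ^ m : ℝ) • slice a x : 𝓢(Config d, ℂ)) : Config d → ℂ) =
          (‖x‖ ^ m : ℝ) • (fun p => a (pt x p)) := rfl
      rw [e, iteratedFDeriv_const_smul_apply
        ((slice_contDiff a x).of_le (by exact_mod_cast le_top)).contDiffAt, norm_smul,
        Real.norm_of_nonneg (by positivity)]
      have := hB i x p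
      linarith
    refine le_trans (le_of_eq ?_) this
    have e2 : ((‖x‖ ^ m : ℝ) • slice a x : 𝓢(Config d, ℂ)) = ((‖x‖ ^ m : ℝ) : ℂ) • slice a x := by
      ext p
      simp
    rw [e2, map_smul_eq_mul, Complex.norm_real, Real.norm_of_nonneg (by positivity)]
  calc ‖x‖ ^ m * ‖w‖ ^ k * ‖FourierTransform.fourier (slice a x) w‖
      = ‖x‖ ^ m * (‖w‖ ^ k * ‖FourierTransform.fourier (slice a x) w‖) := by ring
    _ ≤ ‖x‖ ^ m * (K * ∑ i ∈ s, SchwartzMap.seminorm ℂ i.1 i.2 (slice a x)) := by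
        exact mul_le_mul_of_nonneg_left (h1.trans (mul_le_mul_of_nonneg_left h2 K.2))
          (by positivity)
    _ = K * ∑ i ∈ s, ‖x‖ ^ m * SchwartzMap.seminorm ℂ i.1 i.2 (slice a x) := by
        rw [Finset.mul_sum, Finset.mul_sum, Finset.mul_sum]
        refine Finset.sum_congr rfl fun i _ => by ring
    _ ≤ K * ∑ i ∈ s, B i := by
        refine mul_le_mul_of_nonneg_left (Finset.sum_le_sum fun i _ => h3 i) K.2

theorem weylKer_eq_fourier {d : ℕ} {ε : ℝ} (hε : 0 < ε) (a : 𝓢(Phase d, ℂ)) (q y : Config d) :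
    weylKer ε a q y = FourierTransform.fourier (slice a ((2 : ℝ)⁻¹ • (q + y)))
      ((-(2 * Real.pi * ε)⁻¹) • (q - y)) := by
  rw [SchwartzMap.fourier_coe, Real.fourier_eq']
  refine integral_congr_ae (Filter.Eventually.of_forall fun p => ?_)
  have : ((-2 * Real.pi * inner ℝ p ((-(2 * Real.pi * ε)⁻¹) • (q - y)) : ℝ) : ℂ) * Complex.I =
      Complex.I * ((inner ℝ (q - y) p / ε : ℝ) : ℂ) := by
    rw [mul_comm]
    congr 2
    rw [inner_smul_right, real_inner_comm]
    field_simp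
  simp only [smul_eq_mul]
  rw [this, mul_comm]
  rfl

theorem weylKer_decay {d : ℕ} {ε : ℝ} (hε : 0 < ε) (a : 𝓢(Phase d, ℂ)) (N : ℕ) :
    ∃ C, 0 ≤ C ∧ ∀ q y : Config d,
      ‖weylKer ε a q y‖ ≤ C * (((1 + ‖q‖) ^ N)⁻¹ * ((1 + ‖y‖) ^ N)⁻¹) := by
  obtain ⟨C0, hC0, h0⟩ := slice_fourier_decay a 0 0
  obtain ⟨C1, hC1, h1⟩ := slice_fourier_decay a (2 * N) 0
  obtain ⟨C2, hC2, h2⟩ := slice_fourier_decay a 0 (2 * N)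
  obtain ⟨C3, hC3, h3⟩ := slice_fourier_decay a (2 * N) (2 * N)
  set κ : ℝ := 2 * Real.pi * ε with hκ
  have hκ0 : 0 < κ := by positivity
  set T : ℝ := κ ^ (2 * N) with hT
  have hT0 : 0 < T := by positivity
  refine ⟨4 ^ (2 * N) * (C0 + C1 + T * C2 + T * C3), by positivity, fun q y => ?_⟩
  rw [← mul_inv, ← div_eq_mul_inv, le_div_iff₀ (by positivity)]
  set x : Config d := (2 : ℝ)⁻¹ • (q + y) with hx
  set v : Config d := q - y with hv
  set F : ℝ := ‖weylKer ε a q y‖ with hF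
  have hF0 : 0 ≤ F := norm_nonneg _
  have hw : ‖(-κ⁻¹) • v‖ = κ⁻¹ * ‖v‖ := by
    rw [norm_smul, norm_neg, Real.norm_of_nonneg (by positivity)]
  have hFe : F = ‖FourierTransform.fourier (slice a x) ((-κ⁻¹) • v)‖ := by
    rw [hF, weylKer_eq_fourier hε]
  have hV : ‖v‖ ^ (2 * N) = T * ‖(-κ⁻¹) • v‖ ^ (2 * N) := by
    rw [hw, hT, ← mul_pow]
    congr 1
    field_simp
  have b0 : F ≤ C0 := by
    have := h0 x ((-κ⁻¹) • v)
    rw [← hFe] at this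
    simpa using this
  have b1 : ‖x‖ ^ (2 * N) * F ≤ C1 := by
    have := h1 x ((-κ⁻¹) • v)
    rw [← hFe] at this
    simpa using this
  have b2 : ‖v‖ ^ (2 * N) * F ≤ T * C2 := by
    have := h2 x ((-κ⁻¹) • v)
    rw [← hFe, pow_zero, one_mul] at this
    rw [hV, mul_assoc]
    gcongr
  have b3 : ‖x‖ ^ (2 * N) * ‖v‖ ^ (2 * N) * F ≤ T * C3 := by
    have := h3 x ((-κ⁻¹) • v)
    rw [← hFe] at this
    rw [hV]
    calc _ = T * (‖x‖ ^ (2 * N) * ‖(-κ⁻¹) • v‖ ^ (2 * N) * F) := by ring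
      _ ≤ _ := by gcongr
  have hq : 1 + ‖q‖ ≤ (1 + ‖x‖) * (1 + ‖v‖) := by
    have e : q = x + (2 : ℝ)⁻¹ • v := by
      rw [hx, hv, ← smul_add, add_add_sub_cancel, ← two_smul ℝ q, smul_smul]; simp
    have : ‖q‖ ≤ ‖x‖ + ‖v‖ := by
      calc ‖q‖ = ‖x + (2 : ℝ)⁻¹ • v‖ := by rw [← e]
        _ ≤ ‖x‖ + ‖(2 : ℝ)⁻¹ • v‖ := norm_add_le _ _
        _ ≤ ‖x‖ + ‖v‖ := by
          rw [norm_smul (2 : ℝ)⁻¹ v, Real.norm_of_nonneg (by norm_num)]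
          linarith [norm_nonneg v]
    nlinarith [norm_nonneg x, norm_nonneg v]
  have hy : 1 + ‖y‖ ≤ (1 + ‖x‖) * (1 + ‖v‖) := by
    have e : y = x - (2 : ℝ)⁻¹ • v := by
      rw [hx, hv, ← smul_sub, add_sub_sub_cancel, ← two_smul ℝ y, smul_smul]; simp
    have : ‖y‖ ≤ ‖x‖ + ‖v‖ := by
      calc ‖y‖ = ‖x - (2 : ℝ)⁻¹ • v‖ := by rw [← e]
        _ ≤ ‖x‖ + ‖(2 : ℝ)⁻¹ • v‖ := norm_sub_le _ _
        _ ≤ ‖x‖ + ‖v‖ := by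
          rw [norm_smul (2 : ℝ)⁻¹ v, Real.norm_of_nonneg (by norm_num)]
          linarith [norm_nonneg v]
    nlinarith [norm_nonneg x, norm_nonneg v]
  have hpow : ∀ t : ℝ, 0 ≤ t → (1 + t) ^ (2 * N) ≤ 2 ^ (2 * N) * (1 + t ^ (2 * N)) := by
    intro t ht
    rcases le_total t 1 with h | h
    · calc (1 + t) ^ (2 * N) ≤ 2 ^ (2 * N) := by gcongr; linarith
        _ ≤ _ := le_mul_of_one_le_right (by positivity) (by simp [pow_nonneg ht])
    · calc (1 + t) ^ (2 * N) ≤ (2 * t) ^ (2 * N) := by gcongr; linarith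
        _ = 2 ^ (2 * N) * t ^ (2 * N) := mul_pow _ _ _
        _ ≤ _ := by gcongr; linarith
  calc F * ((1 + ‖q‖) ^ N * (1 + ‖y‖) ^ N)
      ≤ F * (((1 + ‖x‖) * (1 + ‖v‖)) ^ N * ((1 + ‖x‖) * (1 + ‖v‖)) ^ N) := by gcongr
    _ = F * ((1 + ‖x‖) ^ (2 * N) * (1 + ‖v‖) ^ (2 * N)) := by
        rw [← pow_add, ← two_mul, mul_pow]
    _ ≤ F * ((2 ^ (2 * N) * (1 + ‖x‖ ^ (2 * N))) * (2 ^ (2 * N) * (1 + ‖v‖ ^ (2 * N)))) := by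
        gcongr
        · exact hpow _ (norm_nonneg _)
        · exact hpow _ (norm_nonneg _)
    _ = 4 ^ (2 * N) * (F + ‖x‖ ^ (2 * N) * F + ‖v‖ ^ (2 * N) * F +
          ‖x‖ ^ (2 * N) * ‖v‖ ^ (2 * N) * F) := by
        rw [show (4 : ℝ) = 2 * 2 by norm_num, mul_pow]; ring
    _ ≤ 4 ^ (2 * N) * (C0 + C1 + T * C2 + T * C3) := by gcongr

theorem memLp_weight (d : ℕ) :
    MemLp (fun y : Config d => ((1 + ‖y‖) ^ (d + 1))⁻¹) 2 volume := by
  have hc : Continuous (fun y : Config d => ((1 + ‖y‖) ^ (d + 1))⁻¹) :=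
    Continuous.inv₀ (by fun_prop) fun y => by positivity
  rw [memLp_two_iff_integrable_sq hc.aestronglyMeasurable]
  have h := integrable_one_add_norm (E := Config d) (μ := volume) (r := (d + 1 : ℕ))
    (by simp)
  refine h.mono' (hc.pow 2).aestronglyMeasurable (Filter.Eventually.of_forall fun y => ?_)
  rw [Real.rpow_neg (by positivity), Real.rpow_natCast, Real.norm_of_nonneg (by positivity)]
  refine pow_le_of_le_one (by positivity) (inv_le_one_of_one_le₀ ?_) two_ne_zero
  exact one_le_pow₀ (by simp)

theorem weylKer_aesm {d : ℕ} (ε : ℝ) (a : 𝓢(Phase d, ℂ)) (q : Config d) :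
    AEStronglyMeasurable (weylKer ε a q) volume := by
  have : StronglyMeasurable (Function.uncurry fun (y p : Config d) =>
      a (pt ((2 : ℝ)⁻¹ • (q + y)) p) *
      Complex.exp (Complex.I * ((inner ℝ (q - y) p / ε : ℝ) : ℂ))) := by
    refine Continuous.stronglyMeasurable ?_
    simp only [Function.uncurry_def]
    have := a.continuous
    have h2 := (WithLp.prodContinuousLinearEquiv 2 ℝ (Config d) (Config d)).symm.continuous
    refine Continuous.mul (this.comp (h2.comp (by fun_prop))) (by fun_prop)
  exact (this.integral_prod_right).aestronglyMeasurable

theorem weylFun_aesm {d : ℕ} (ε : ℝ) (a : 𝓢(Phase d, ℂ)) (ψ : L2 d) :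
    AEStronglyMeasurable (weylFun ε a ψ) volume := by
  have h : StronglyMeasurable (Function.uncurry fun (x : Config d × Config d) (p : Config d) =>
      a (pt ((2 : ℝ)⁻¹ • (x.1 + x.2)) p) *
      Complex.exp (Complex.I * ((inner ℝ (x.1 - x.2) p / ε : ℝ) : ℂ)) * ψ x.2) := by
    refine StronglyMeasurable.mul (Continuous.stronglyMeasurable ?_) ?_
    · have := a.continuous
      have h2 := (WithLp.prodContinuousLinearEquiv 2 ℝ (Config d) (Config d)).symm.continuous
      refine Continuous.mul (this.comp (h2.comp (by fun_prop))) (by fun_prop)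
    · exact (Lp.stronglyMeasurable ψ).comp_measurable (by fun_prop)
  have h' : StronglyMeasurable (Function.uncurry fun (q y : Config d) => ∫ p : Config d,
      a (pt ((2 : ℝ)⁻¹ • (q + y)) p) *
      Complex.exp (Complex.I * ((inner ℝ (q - y) p / ε : ℝ) : ℂ)) * ψ y) :=
    h.integral_prod_right
  exact (h'.integral_prod_right.const_mul _).aestronglyMeasurable

theorem weight_mul_integrable {d : ℕ} (ψ : L2 d) :
    Integrable (fun y : Config d => ((1 + ‖y‖) ^ (d + 1))⁻¹ * ‖ψ y‖) :=
  (memLp_weight d).integrable_mul (Lp.memLp ψ).norm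

theorem weylKer_integrable {d : ℕ} {ε : ℝ} (hε : 0 < ε) (a : 𝓢(Phase d, ℂ)) (ψ : L2 d)
    (q : Config d) : Integrable (fun y => weylKer ε a q y * ψ y) := by
  obtain ⟨C, hC, h⟩ := weylKer_decay hε a (d + 1)
  refine ((weight_mul_integrable ψ).const_mul (C * ((1 + ‖q‖) ^ (d + 1))⁻¹)).mono'
    ((weylKer_aesm ε a q).mul (Lp.aestronglyMeasurable ψ))
    (Filter.Eventually.of_forall fun y => ?_)
  rw [norm_mul]
  calc ‖weylKer ε a q y‖ * ‖ψ y‖ ≤ _ := mul_le_mul_of_nonneg_right (h q y) (norm_nonneg _)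
    _ = _ := by ring

theorem weight_integral_le (d : ℕ) :
    ∃ C, 0 ≤ C ∧ ∀ ψ : L2 d, ∫ y : Config d, ((1 + ‖y‖) ^ (d + 1))⁻¹ * ‖ψ y‖ ≤ C * ‖ψ‖ := by
  refine ⟨‖(memLp_weight d).toLp _‖, norm_nonneg _, fun ψ => ?_⟩
  have hn : ‖(Lp.memLp ψ).norm.toLp‖ = ‖ψ‖ := by
    rw [Lp.norm_toLp, eLpNorm_norm, Lp.norm_def]
  rw [← hn]
  refine le_trans (le_of_eq ?_)
    (real_inner_le_norm ((memLp_weight d).toLp _) (Lp.memLp ψ).norm.toLp)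
  rw [L2.inner_def]
  refine integral_congr_ae ?_
  filter_upwards [(memLp_weight d).coeFn_toLp, (Lp.memLp ψ).norm.coeFn_toLp] with y h1 h2
  rw [h1, h2]
  simp [mul_comm]

theorem weylFun_bound {d : ℕ} {ε : ℝ} (hε : 0 < ε) (a : 𝓢(Phase d, ℂ)) :
    ∃ C, 0 ≤ C ∧ ∀ (ψ : L2 d) (q : Config d),
      ‖weylFun ε a ψ q‖ ≤ C * ‖ψ‖ * ‖((1 + ‖q‖) ^ (d + 1))⁻¹‖ := by
  obtain ⟨C, hC, h⟩ := weylKer_decay hε a (d + 1)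
  obtain ⟨B, hB, hw⟩ := weight_integral_le d
  refine ⟨((2 * Real.pi * ε) ^ d)⁻¹ * (C * B), by positivity, fun ψ q => ?_⟩
  rw [weylFun_eq, norm_mul, Complex.norm_real, Real.norm_of_nonneg (by positivity),
    Real.norm_of_nonneg (by positivity)]
  have : ‖∫ y : Config d, weylKer ε a q y * ψ y‖ ≤
      ∫ y : Config d, (C * ((1 + ‖q‖) ^ (d + 1))⁻¹) * (((1 + ‖y‖) ^ (d + 1))⁻¹ * ‖ψ y‖) := by
    refine norm_integral_le_of_norm_le ((weight_mul_integrable ψ).const_mul _)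
      (Filter.Eventually.of_forall fun y => ?_)
    rw [norm_mul]
    calc ‖weylKer ε a q y‖ * ‖ψ y‖ ≤ _ := mul_le_mul_of_nonneg_right (h q y) (norm_nonneg _)
      _ = _ := by ring
  rw [integral_const_mul] at this
  calc ((2 * Real.pi * ε) ^ d)⁻¹ * ‖∫ y : Config d, weylKer ε a q y * ψ y‖
      ≤ ((2 * Real.pi * ε) ^ d)⁻¹ * ((C * ((1 + ‖q‖) ^ (d + 1))⁻¹) * (B * ‖ψ‖)) := by
        gcongr
        exact this.trans (mul_le_mul_of_nonneg_left (hw ψ) (by positivity))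
    _ = _ := by ring

theorem memLp_weylFun {d : ℕ} {ε : ℝ} (hε : 0 < ε) (a : 𝓢(Phase d, ℂ)) (ψ : L2 d) :
    MemLp (weylFun ε a ψ) 2 volume := by
  obtain ⟨C, -, h⟩ := weylFun_bound hε a
  exact MemLp.of_le_mul (memLp_weight d) (weylFun_aesm ε a ψ) (Filter.Eventually.of_forall (h ψ))

theorem weylFun_add {d : ℕ} {ε : ℝ} (hε : 0 < ε) (a : 𝓢(Phase d, ℂ)) (ψ φ : L2 d) :
    weylFun ε a ↑↑(ψ + φ) = weylFun ε a ψ + weylFun ε a φ := by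
  funext q
  rw [Pi.add_apply, weylFun_eq, weylFun_eq, weylFun_eq, ← mul_add,
    ← integral_add (weylKer_integrable hε a ψ q) (weylKer_integrable hε a φ q)]
  congr 1
  refine integral_congr_ae ?_
  filter_upwards [Lp.coeFn_add ψ φ] with y hy
  rw [hy, Pi.add_apply, mul_add]

theorem weylFun_smul {d : ℕ} (ε : ℝ) (a : 𝓢(Phase d, ℂ)) (c : ℂ) (ψ : L2 d) :
    weylFun ε a ↑↑(c • ψ) = c • weylFun ε a ψ := by
  funext q
  have h : ∫ y : Config d, weylKer ε a q y * (c • ψ : L2 d) y =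
      c * ∫ y : Config d, weylKer ε a q y * ψ y := by
    rw [← integral_const_mul]
    refine integral_congr_ae ?_
    filter_upwards [Lp.coeFn_smul c ψ] with y hy
    rw [hy, Pi.smul_apply, smul_eq_mul, mul_left_comm]
  rw [Pi.smul_apply, weylFun_eq, weylFun_eq, h, smul_eq_mul, mul_left_comm]

/-- The Weyl quantization `op^We(a)` of a Schwartz function, as a bounded operator on `L²(ℝ^d)`:
the class of `ψ` is sent to the class of `weylFun ε a ψ`. -/
def opWe {d : ℕ} (ε : ℝ) (hε : 0 < ε) (a : 𝓢(Phase d, ℂ)) : L2 d →L[ℂ] L2 d :=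
  LinearMap.mkContinuousOfExistsBound
    { toFun := fun ψ => (memLp_weylFun hε a ψ).toLp (weylFun ε a ψ)
      map_add' := fun ψ φ => by
        rw [← MemLp.toLp_add]
        exact MemLp.toLp_congr _ _ (by rw [weylFun_add hε])
      map_smul' := fun c ψ => by
        rw [RingHom.id_apply, ← MemLp.toLp_const_smul]
        exact MemLp.toLp_congr _ _ (by rw [weylFun_smul]) }
    (by
      obtain ⟨C, hC, h⟩ := weylFun_bound hε a
      refine ⟨C * ‖(memLp_weight d).toLp _‖, fun ψ => ?_⟩
      have : ‖(memLp_weylFun hε a ψ).toLp (weylFun ε a ψ)‖ ≤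
          (C * ‖ψ‖) * ‖(memLp_weight d).toLp _‖ := by
        refine Lp.norm_le_mul_norm_of_ae_le_mul ?_
        filter_upwards [(memLp_weylFun hε a ψ).coeFn_toLp, (memLp_weight d).coeFn_toLp]
          with q h1 h2
        rw [h1, h2]
        exact h ψ q
      refine le_trans this (le_of_eq ?_)
      ring)

/-- `opWe` acts by the integral formula `weylFun`. -/
theorem opWe_coeFn {d : ℕ} (ε : ℝ) (hε : 0 < ε) (a : 𝓢(Phase d, ℂ)) (ψ : L2 d) :
    opWe ε hε a ψ =ᵐ[volume] weylFun ε a ψ :=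
  MemLp.coeFn_toLp (memLp_weylFun hε a ψ)

/-! ### Anti-Wick quantization -/

theorem gaussian_contDiff (d : ℕ) (ε : ℝ) :
    ContDiff ℝ (⊤ : ℕ∞) (fun z : Phase d => Real.exp (-‖z‖ ^ 2 / ε)) :=
  Real.contDiff_exp.comp (((contDiff_norm_sq ℝ).neg).div_const ε)

theorem gaussian_decay (d : ℕ) {ε : ℝ} (hε : 0 < ε) (k n : ℕ) :
    ∃ C, ∀ z : Phase d,
      ‖z‖ ^ k * ‖iteratedFDeriv ℝ n (fun z : Phase d => Real.exp (-‖z‖ ^ 2 / ε)) z‖ ≤ C := by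
  have htg : Function.HasTemperateGrowth (fun z : Phase d => -‖z‖ ^ 2 / ε) := by
    have := (Function.HasTemperateGrowth.const (E := Phase d) (-ε⁻¹)).mul
      (Function.hasTemperateGrowth_norm_sq (Phase d))
    have e : (fun z : Phase d => -‖z‖ ^ 2 / ε) =
        (fun _ : Phase d => -ε⁻¹) * fun z : Phase d => ‖z‖ ^ 2 := by
      funext z
      simp only [Pi.mul_apply]
      ring
    rw [e]
    exact this
  obtain ⟨l, C, hC, hgrowth⟩ := htg.norm_iteratedFDeriv_le_uniform n
  refine ⟨n.factorial * (C + 1) ^ n * ((k + l * n).factorial * Real.exp (1 + ε / 4)),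
    fun z => ?_⟩
  have hexp : ∀ i ≤ n, ‖iteratedFDeriv ℝ i Real.exp (-‖z‖ ^ 2 / ε)‖ ≤
      Real.exp (-‖z‖ ^ 2 / ε) := by
    intro i _
    rw [norm_iteratedFDeriv_eq_norm_iteratedDeriv, iteratedDeriv_eq_iterate, Real.iter_deriv_exp,
      Real.norm_of_nonneg (Real.exp_pos _).le]
  have hD : ∀ i, 1 ≤ i → i ≤ n → ‖iteratedFDeriv ℝ i (fun z : Phase d => -‖z‖ ^ 2 / ε) z‖ ≤
      ((C + 1) * (1 + ‖z‖) ^ l) ^ i := by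
    intro i h1 h2
    refine (hgrowth i h2 z).trans ?_
    have h1z : (1 : ℝ) ≤ 1 + ‖z‖ := by simp
    calc C * (1 + ‖z‖) ^ l ≤ (C + 1) * (1 + ‖z‖) ^ l := by gcongr; simp
      _ ≤ _ := le_self_pow₀ (one_le_mul_of_one_le_of_one_le (by simp [hC]) (one_le_pow₀ h1z))
        (by omega)
  have key := norm_iteratedFDeriv_comp_le (n := n) (N := (⊤ : ℕ∞)) Real.contDiff_exp htg.1
    (by exact_mod_cast le_top) z hexp hD
  have hpow : (1 + ‖z‖) ^ (k + l * n) ≤ (k + l * n).factorial * Real.exp (1 + ‖z‖) := by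
    have := Real.pow_div_factorial_le_exp (x := 1 + ‖z‖) (by positivity) (k + l * n)
    rwa [div_le_iff₀' (by positivity)] at this
  have hq : 1 + ‖z‖ + -‖z‖ ^ 2 / ε ≤ 1 + ε / 4 := by
    have : ‖z‖ + -‖z‖ ^ 2 / ε - ε / 4 = -((‖z‖ - ε / 2) ^ 2) / ε := by
      field_simp
      ring
    have h2 : -((‖z‖ - ε / 2) ^ 2) / ε ≤ 0 :=
      div_nonpos_of_nonpos_of_nonneg (by simp [sq_nonneg]) hε.le
    linarith
  calc ‖z‖ ^ k * ‖iteratedFDeriv ℝ n (fun z : Phase d => Real.exp (-‖z‖ ^ 2 / ε)) z‖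
      ≤ (1 + ‖z‖) ^ k * (n.factorial * Real.exp (-‖z‖ ^ 2 / ε) *
          ((C + 1) * (1 + ‖z‖) ^ l) ^ n) := by
        gcongr
        · simp
        · exact key
    _ = n.factorial * (C + 1) ^ n * ((1 + ‖z‖) ^ (k + l * n) * Real.exp (-‖z‖ ^ 2 / ε)) := by
        rw [mul_pow, pow_add, pow_mul]; ring
    _ ≤ n.factorial * (C + 1) ^ n * ((k + l * n).factorial * Real.exp (1 + ‖z‖) *
          Real.exp (-‖z‖ ^ 2 / ε)) := by gcongr
    _ = n.factorial * (C + 1) ^ n * ((k + l * n).factorial *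
          Real.exp (1 + ‖z‖ + -‖z‖ ^ 2 / ε)) := by rw [Real.exp_add (1 + ‖z‖)]; ring
    _ ≤ _ := by gcongr

/-- The phase space Gaussian `G_{ε/2}(z) = (πε)^{-d} e^{-|z|²/ε}`. -/
def gaussian (d : ℕ) (ε : ℝ) (hε : 0 < ε) : 𝓢(Phase d, ℝ) where
  toFun z := ((Real.pi * ε) ^ d)⁻¹ * Real.exp (-‖z‖ ^ 2 / ε)
  smooth' := contDiff_const.mul (gaussian_contDiff d ε)
  decay' k n := by
    obtain ⟨C, hC⟩ := gaussian_decay d hε k n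
    refine ⟨((Real.pi * ε) ^ d)⁻¹ * C, fun z => ?_⟩
    have e : (fun z : Phase d => ((Real.pi * ε) ^ d)⁻¹ * Real.exp (-‖z‖ ^ 2 / ε)) =
        ((Real.pi * ε) ^ d)⁻¹ • (fun z : Phase d => Real.exp (-‖z‖ ^ 2 / ε)) := rfl
    rw [e, iteratedFDeriv_const_smul_apply
      ((gaussian_contDiff d ε).of_le (by exact_mod_cast le_top)).contDiffAt, norm_smul,
      Real.norm_of_nonneg (by positivity), mul_left_comm]
    gcongr
    exact hC z

/-- The convolution `a * G_{ε/2}`. -/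
def gaussConv {d : ℕ} (ε : ℝ) (hε : 0 < ε) (a : 𝓢(Phase d, ℂ)) : 𝓢(Phase d, ℂ) :=
  SchwartzMap.convolution (ContinuousLinearMap.mul ℂ ℂ) a (toComplex (gaussian d ε hε))

theorem gaussConv_apply {d : ℕ} (ε : ℝ) (hε : 0 < ε) (a : 𝓢(Phase d, ℂ)) (z : Phase d) :
    gaussConv ε hε a z =
      ∫ ζ : Phase d, a ζ * ((((Real.pi * ε) ^ d)⁻¹ * Real.exp (-‖z - ζ‖ ^ 2 / ε) : ℝ) : ℂ) := by
  rw [gaussConv, SchwartzMap.convolution_apply]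
  rfl

/-- The Anti-Wick quantization `op^AW(a) = op^We(a * G_{ε/2})`. -/
def opAW {d : ℕ} (ε : ℝ) (hε : 0 < ε) (a : 𝓢(Phase d, ℂ)) : L2 d →L[ℂ] L2 d :=
  opWe ε hε (gaussConv ε hε a)

/-! ### The coefficients of the expansion -/

theorem comp_fst_bound {d : ℕ} (a : 𝓢(Phase d, ℂ)) (i : ℕ) (x : Phase d × Phase d) :
    ‖iteratedFDeriv ℝ i (fun x : Phase d × Phase d => a x.1) x‖ ≤ ‖iteratedFDeriv ℝ i a x.1‖ := by
  have h := (ContinuousLinearMap.fst ℝ (Phase d) (Phase d)).iteratedFDeriv_comp_right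
    (a.smooth ⊤) x (i := i) (by exact_mod_cast le_top)
  change ‖iteratedFDeriv ℝ i (a ∘ ContinuousLinearMap.fst ℝ (Phase d) (Phase d)) x‖ ≤ _
  rw [h]
  refine (ContinuousMultilinearMap.norm_compContinuousLinearMap_le _ _).trans ?_
  refine mul_le_of_le_one_right (norm_nonneg _) ?_
  exact Finset.prod_le_one (fun _ _ => norm_nonneg _)
    fun _ _ => ContinuousLinearMap.norm_fst_le ℝ _ _

theorem comp_snd_bound {d : ℕ} (a : 𝓢(Phase d, ℂ)) (i : ℕ) (x : Phase d × Phase d) :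
    ‖iteratedFDeriv ℝ i (fun x : Phase d × Phase d => a x.2) x‖ ≤ ‖iteratedFDeriv ℝ i a x.2‖ := by
  have h := (ContinuousLinearMap.snd ℝ (Phase d) (Phase d)).iteratedFDeriv_comp_right
    (a.smooth ⊤) x (i := i) (by exact_mod_cast le_top)
  change ‖iteratedFDeriv ℝ i (a ∘ ContinuousLinearMap.snd ℝ (Phase d) (Phase d)) x‖ ≤ _
  rw [h]
  refine (ContinuousMultilinearMap.norm_compContinuousLinearMap_le _ _).trans ?_
  refine mul_le_of_le_one_right (norm_nonneg _) ?_
  exact Finset.prod_le_one (fun _ _ => norm_nonneg _)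
    fun _ _ => ContinuousLinearMap.norm_snd_le ℝ _ _

/-- The tensor product `(z, w) ↦ a(z) b(w)`. -/
def tensor {d : ℕ} (a b : 𝓢(Phase d, ℂ)) : 𝓢(Phase d × Phase d, ℂ) where
  toFun x := a x.1 * b x.2
  smooth' := ((a.smooth ⊤).comp contDiff_fst).mul ((b.smooth ⊤).comp contDiff_snd)
  decay' k n := by
    refine ⟨∑ i ∈ Finset.range (n + 1), (n.choose i : ℝ) *
      (SchwartzMap.seminorm ℝ k i a * SchwartzMap.seminorm ℝ 0 (n - i) b +
        SchwartzMap.seminorm ℝ 0 i a * SchwartzMap.seminorm ℝ k (n - i) b), fun x => ?_⟩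
    have hmul := norm_iteratedFDeriv_mul_le (𝕜 := ℝ) (N := (⊤ : ℕ∞)) (n := n)
      ((a.smooth ⊤).comp contDiff_fst : ContDiff ℝ _ fun x : Phase d × Phase d => a x.1)
      ((b.smooth ⊤).comp contDiff_snd : ContDiff ℝ _ fun x : Phase d × Phase d => b x.2)
      x (by exact_mod_cast le_top)
    have hnorm : ‖x‖ ^ k ≤ ‖x.1‖ ^ k + ‖x.2‖ ^ k := by
      rw [Prod.norm_def]
      rcases max_choice ‖x.1‖ ‖x.2‖ with h | h <;> rw [h]
      · exact le_add_of_nonneg_right (by positivity)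
      · exact le_add_of_nonneg_left (by positivity)
    refine (mul_le_mul_of_nonneg_left hmul (by positivity)).trans ?_
    rw [Finset.mul_sum]
    refine Finset.sum_le_sum fun i _ => ?_
    have a0 : ‖iteratedFDeriv ℝ i a x.1‖ ≤ SchwartzMap.seminorm ℝ 0 i a :=
      SchwartzMap.norm_iteratedFDeriv_le_seminorm ℝ a i x.1
    have b0 : ‖iteratedFDeriv ℝ (n - i) b x.2‖ ≤ SchwartzMap.seminorm ℝ 0 (n - i) b :=
      SchwartzMap.norm_iteratedFDeriv_le_seminorm ℝ b (n - i) x.2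
    have ak := SchwartzMap.le_seminorm ℝ k i a x.1
    have bk := SchwartzMap.le_seminorm ℝ k (n - i) b x.2
    set A := ‖iteratedFDeriv ℝ i a x.1‖
    set B := ‖iteratedFDeriv ℝ (n - i) b x.2‖
    have hA : 0 ≤ A := norm_nonneg _
    have hB : 0 ≤ B := norm_nonneg _
    calc ‖x‖ ^ k * ((n.choose i : ℝ) *
          ‖iteratedFDeriv ℝ i (fun x : Phase d × Phase d => a x.1) x‖ *
          ‖iteratedFDeriv ℝ (n - i) (fun x : Phase d × Phase d => b x.2) x‖)
        ≤ (‖x.1‖ ^ k + ‖x.2‖ ^ k) * ((n.choose i : ℝ) * A * B) := by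
          gcongr
          · exact comp_fst_bound a i x
          · exact comp_snd_bound b (n - i) x
      _ = (n.choose i : ℝ) * ((‖x.1‖ ^ k * A) * B + A * (‖x.2‖ ^ k * B)) := by ring
      _ ≤ _ := by gcongr

/-- Restriction `F ↦ (z ↦ F(z, z))` to the diagonal `w = z`. -/
def diag {d : ℕ} : 𝓢(Phase d × Phase d, ℂ) →L[ℂ] 𝓢(Phase d, ℂ) :=
  SchwartzMap.compCLM ℂ
    (g := fun z : Phase d => (z, z))
    (((ContinuousLinearMap.id ℝ (Phase d)).prod
      (ContinuousLinearMap.id ℝ (Phase d))).hasTemperateGrowth)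
    ⟨1, 1, fun z => by simp [Prod.norm_def]⟩

theorem diag_apply {d : ℕ} (F : 𝓢(Phase d × Phase d, ℂ)) (z : Phase d) :
    diag F z = F (z, z) := rfl

/-- The coordinate direction `∂/∂q_j` of phase space. -/
def dirQ {d : ℕ} (j : Fin d) : Phase d := pt (EuclideanSpace.single j 1) 0

/-- The coordinate direction `∂/∂p_j` of phase space. -/
def dirP {d : ℕ} (j : Fin d) : Phase d := pt 0 (EuclideanSpace.single j 1)

/-- Directional derivative in the first variable `z` of functions of `(z, w)`. -/
def dz {d : ℕ} (u : Phase d) : 𝓢(Phase d × Phase d, ℂ) →L[ℂ] 𝓢(Phase d × Phase d, ℂ) :=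
  LineDeriv.lineDerivOpCLM ℂ 𝓢(Phase d × Phase d, ℂ) ((u, 0) : Phase d × Phase d)

/-- Directional derivative in the second variable `w` of functions of `(z, w)`. -/
def dw {d : ℕ} (u : Phase d) : 𝓢(Phase d × Phase d, ℂ) →L[ℂ] 𝓢(Phase d × Phase d, ℂ) :=
  LineDeriv.lineDerivOpCLM ℂ 𝓢(Phase d × Phase d, ℂ) ((0, u) : Phase d × Phase d)

/-- The operator `(∇_z, ∇_w)`. -/
def gradGrad (d : ℕ) : 𝓢(Phase d × Phase d, ℂ) →L[ℂ] 𝓢(Phase d × Phase d, ℂ) :=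
  ∑ j : Fin d, (dz (dirQ j) ∘L dw (dirQ j) + dz (dirP j) ∘L dw (dirP j))

/-- The operator `(J∇_z, ∇_w)` with `J (q, p) = (p, -q)`, that is `J∇ = (∇_p, -∇_q)`. -/
def symplGrad (d : ℕ) : 𝓢(Phase d × Phase d, ℂ) →L[ℂ] 𝓢(Phase d × Phase d, ℂ) :=
  ∑ j : Fin d, (dz (dirP j) ∘L dw (dirQ j) - dz (dirQ j) ∘L dw (dirP j))

/-- `λ_m(a,b)(z) = ((-1)^m / (2^m m!)) [((∇_z,∇_w) + i (J∇_z,∇_w))^m (a(z) b(w))]_{w = z}`. -/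
def lam {d : ℕ} (m : ℕ) (a b : 𝓢(Phase d, ℂ)) : 𝓢(Phase d, ℂ) :=
  ((-1 : ℂ) ^ m / ((2 : ℂ) ^ m * (m.factorial : ℂ))) •
    diag (((gradGrad d + Complex.I • symplGrad d) ^ m) (tensor a b))

end AntiWick

end

/-
Fourier inversion writes a symbol as a superposition of the plane waves `z ↦ e^{2πi z·ζ}`. The Weyl
quantization of a plane wave is a unitary phase space translation `T_ζ`, so `op^We` sends the
superposition with amplitudes `F` to `∫ F(ζ) T_ζ dζ`, of norm at most `‖F‖₁`, and
`T_ζ T_ω = e^{iφ} T_{ζ+ω}` with `φ = 2π²ε σ(ζ, ω)` for the symplectic form `σ`. Convolution with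
`G_{ε/2}` multiplies the amplitude at `ζ` by `g(ζ) = e^{-π²ε|ζ|²}`. Expanding `|ζ + ω|²`, one gets

  `g(ζ) g(ω) e^{iφ} = g(ζ + ω) e^{εθ}`  with  `θ = 2π² (ζ·ω + i σ(ζ, ω))`,

and `-2θ` is the symbol of `(∇_z, ∇_w) + i (J∇_z, ∇_w)`. Hence the Taylor expansion of `e^{εθ}`
gives the expansion of `op^AW(a) op^AW(b)`. Its remainder is at most `|εθ|^{n+1} / n!` times the
larger of `1` and `e^{ε Re θ}`, and the factor `g(ζ + ω)` in front of it absorbs the latter, because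
`g(ζ + ω) ≤ 1` and `g(ζ + ω) e^{ε Re θ} = g(ζ) g(ω) ≤ 1`.
-/

noncomputable section

namespace AntiWick

open scoped FourierTransform InnerProductSpace Topology

section Modulation

variable {α : Type*} [MeasurableSpace α] {μ : Measure α} {g : α → Circle}

theorem memLp_circle_smul (hg : AEStronglyMeasurable g μ) (ψ : Lp ℂ 2 μ) :
    MemLp (fun q => g q • ψ q) 2 μ :=
  (memLp_congr_norm (hg.smul (Lp.aestronglyMeasurable ψ))
    (Lp.aestronglyMeasurable ψ) (.of_forall fun q => Circle.norm_smul (g q) (ψ q))).2 (Lp.memLp ψ)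

/-- Multiplication by a unimodular function, as an isometry of `L²`. -/
def modulation (g : α → Circle) (hg : AEStronglyMeasurable g μ) : Lp ℂ 2 μ →ₗᵢ[ℂ] Lp ℂ 2 μ where
  toFun ψ := (memLp_circle_smul hg ψ).toLp
  map_add' ψ φ := by
    rw [← MemLp.toLp_add]
    refine MemLp.toLp_congr _ _ ?_
    filter_upwards [Lp.coeFn_add ψ φ] with q hq
    simp only [hq, Pi.add_apply, smul_add]
  map_smul' c ψ := by
    rw [RingHom.id_apply, ← MemLp.toLp_const_smul]
    refine MemLp.toLp_congr _ _ ?_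
    filter_upwards [Lp.coeFn_smul c ψ] with q hq
    simp only [hq, Pi.smul_apply, smul_comm c]
  norm_map' ψ := by
    rw [LinearMap.coe_mk, AddHom.coe_mk, Lp.norm_toLp, Lp.norm_def]
    exact congrArg _ (eLpNorm_congr_norm_ae (.of_forall fun q => Circle.norm_smul (g q) (ψ q)))

theorem coeFn_modulation (hg : AEStronglyMeasurable g μ) (ψ : Lp ℂ 2 μ) :
    modulation g hg ψ =ᵐ[μ] fun q => g q • ψ q :=
  (memLp_circle_smul hg ψ).coeFn_toLp

theorem continuous_inner_modulation {X : Type*} [TopologicalSpace X] [FirstCountableTopology X]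
    {g : X → α → Circle} (hg : ∀ x, AEStronglyMeasurable (g x) μ)
    (hcont : ∀ q, Continuous fun x => g x q) (χ ψ : Lp ℂ 2 μ) :
    Continuous fun x => ⟪χ, modulation (g x) (hg x) ψ⟫_ℂ := by
  have h_eq (x : X) : ⟪χ, modulation (g x) (hg x) ψ⟫_ℂ = ∫ q, g x q • ⟪χ q, ψ q⟫_ℂ ∂μ := by
    rw [L2.inner_def]
    refine integral_congr_ae ?_
    filter_upwards [coeFn_modulation (hg x) ψ] with q hq
    rw [hq, Circle.smul_def, Circle.smul_def, inner_smul_right, smul_eq_mul]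
  have h_int : Integrable (fun q => ⟪χ q, ψ q⟫_ℂ) μ := L2.integrable_inner χ ψ
  simp only [h_eq]
  exact continuous_of_dominated
    (fun x => (hg x).smul h_int.aestronglyMeasurable)
    (fun x => .of_forall fun q => (Circle.norm_smul (g x q) _).le) h_int.norm
    (.of_forall fun q => (hcont q).smul continuous_const)

theorem norm_sub_sq_of_norm_eq {H : Type*} [NormedAddCommGroup H] [InnerProductSpace ℂ H]
    {x y : H} (h : ‖x‖ = ‖y‖) : ‖x - y‖ ^ 2 = 2 * (‖y‖ ^ 2 - (⟪y, x⟫_ℂ).re) := by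
  rw [@norm_sub_sq ℂ, h, ← inner_conj_symm, RCLike.conj_re]
  simp only [RCLike.re_to_complex]
  ring

/-- Since modulations are isometries, strong continuity follows from weak continuity. -/
theorem continuous_modulation_apply {X : Type*} [TopologicalSpace X] [FirstCountableTopology X]
    {g : X → α → Circle} (hg : ∀ x, AEStronglyMeasurable (g x) μ)
    (hcont : ∀ q, Continuous fun x => g x q) (ψ : Lp ℂ 2 μ) :
    Continuous fun x => modulation (g x) (hg x) ψ := by
  refine continuous_iff_continuousAt.2 fun x₀ => tendsto_iff_norm_sub_tendsto_zero.2 ?_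
  set φ := modulation (g x₀) (hg x₀) ψ
  have h_eq (x : X) : ‖modulation (g x) (hg x) ψ - φ‖ =
      √(2 * (‖φ‖ ^ 2 - (⟪φ, modulation (g x) (hg x) ψ⟫_ℂ).re)) := by
    rw [← norm_sub_sq_of_norm_eq (by simp only [φ, LinearIsometry.norm_map]),
      Real.sqrt_sq (norm_nonneg _)]
  have h_cont : Continuous fun x => √(2 * (‖φ‖ ^ 2 - (⟪φ, modulation (g x) (hg x) ψ⟫_ℂ).re)) := by
    have := continuous_inner_modulation hg hcont φ ψ
    fun_prop
  have h_tendsto := h_cont.tendsto x₀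
  rw [← h_eq, sub_self, norm_zero] at h_tendsto
  exact h_tendsto.congr fun x => (h_eq x).symm

theorem continuous_modulation {X : Type*} [TopologicalSpace X] [FirstCountableTopology X]
    {g : X → α → Circle} (hg : ∀ x, AEStronglyMeasurable (g x) μ)
    (hcont : ∀ q, Continuous fun x => g x q) {ψ : X → Lp ℂ 2 μ} (hψ : Continuous ψ) :
    Continuous fun x => modulation (g x) (hg x) (ψ x) := by
  refine continuous_iff_continuousAt.2 fun x₀ => ?_
  have h_diff : Filter.Tendsto (fun x => modulation (g x) (hg x) (ψ x - ψ x₀)) (𝓝 x₀) (𝓝 0) := by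
    rw [tendsto_zero_iff_norm_tendsto_zero]
    simp only [LinearIsometry.norm_map]
    exact tendsto_iff_norm_sub_tendsto_zero.1 (hψ.tendsto x₀)
  have h_fixed := (continuous_modulation_apply hg hcont (ψ x₀)).tendsto x₀
  have h_add := h_diff.add h_fixed
  simp only [← map_add, sub_add_cancel, zero_add] at h_add
  exact h_add

end Modulation

section Translation

variable {d : ℕ}

/-- The phase of the Weyl translation by `ζ = (ζ₁, ζ₂)`. -/
def weylPhase (ε : ℝ) (ζ : Phase d) (q : Config d) : Circle :=
  𝐞 ⟪ζ.fst, q + (Real.pi * ε) • ζ.snd⟫_ℝ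

theorem aestronglyMeasurable_weylPhase (ε : ℝ) (ζ : Phase d) :
    AEStronglyMeasurable (weylPhase ε ζ) volume := by
  refine Continuous.aestronglyMeasurable ?_
  unfold weylPhase
  fun_prop

/-- `T_ζ`, the Weyl quantization of the plane wave `z ↦ e^{2πi z·ζ}`:
`(T_ζ ψ)(q) = e^{2πi ζ₁·(q + πε ζ₂)} ψ(q + 2πε ζ₂)`. -/
def weylTranslation (ε : ℝ) (ζ : Phase d) : L2 d →ₗᵢ[ℂ] L2 d :=
  (modulation (weylPhase ε ζ) (aestronglyMeasurable_weylPhase ε ζ)).comp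
    (Lp.compMeasurePreservingₗᵢ ℂ (· + (2 * Real.pi * ε) • ζ.snd)
      (measurePreserving_add_right volume _))

theorem coeFn_weylTranslation (ε : ℝ) (ζ : Phase d) (ψ : L2 d) :
    weylTranslation ε ζ ψ =ᵐ[volume]
      fun q => weylPhase ε ζ q • ψ (q + (2 * Real.pi * ε) • ζ.snd) := by
  have h_shift := measurePreserving_add_right (volume : Measure (Config d))
    ((2 * Real.pi * ε) • ζ.snd)
  filter_upwards [coeFn_modulation (aestronglyMeasurable_weylPhase ε ζ)
      (Lp.compMeasurePreservingₗᵢ ℂ _ h_shift ψ),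
    Lp.coeFn_compMeasurePreserving ψ h_shift] with q h_mod h_comp
  exact h_mod.trans (congrArg (weylPhase ε ζ q • ·) h_comp)

theorem continuous_weylTranslation (ε : ℝ) (ψ : L2 d) :
    Continuous fun ζ : Phase d => weylTranslation ε ζ ψ := by
  let shift (ζ : Phase d) : C(Config d, Config d) :=
    (ContinuousMap.id _) + .const _ ((2 * Real.pi * ε) • ζ.snd)
  have h_shift : Continuous shift :=
    continuous_const.add (ContinuousMap.continuous_const'.comp (by fun_prop))
  have h_preserving (ζ : Phase d) : MeasurePreserving (shift ζ) volume volume :=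
    measurePreserving_add_right volume ((2 * Real.pi * ε) • ζ.snd)
  have h_translate : Continuous fun ζ => Lp.compMeasurePreserving (shift ζ) (h_preserving ζ) ψ :=
    continuous_const.compMeasurePreservingLp h_shift h_preserving ENNReal.ofNat_ne_top
  have h_phase (q : Config d) : Continuous fun ζ : Phase d => weylPhase ε ζ q := by
    unfold weylPhase
    fun_prop
  exact continuous_modulation (aestronglyMeasurable_weylPhase ε) h_phase h_translate

/-- The symplectic form `σ(ζ, ω) = ζ₂·ω₁ - ζ₁·ω₂`. -/
def symplecticForm (ζ ω : Phase d) : ℝ :=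
  ⟪ζ.snd, ω.fst⟫_ℝ - ⟪ζ.fst, ω.snd⟫_ℝ

theorem weylPhase_mul_weylPhase (ε : ℝ) (ζ ω : Phase d) (q : Config d) :
    weylPhase ε ζ q * weylPhase ε ω (q + (2 * Real.pi * ε) • ζ.snd) =
      𝐞 (Real.pi * ε * symplecticForm ζ ω) * weylPhase ε (ζ + ω) q := by
  simp only [weylPhase, symplecticForm, ← AddChar.map_add_eq_mul, WithLp.add_fst, WithLp.add_snd,
    smul_add, inner_add_left, inner_add_right, real_inner_smul_right, real_inner_comm ω.fst]
  ring_nf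

theorem weylTranslation_weylTranslation (ε : ℝ) (ζ ω : Phase d) (ψ : L2 d) :
    weylTranslation ε ζ (weylTranslation ε ω ψ) =
      𝐞 (Real.pi * ε * symplecticForm ζ ω) • weylTranslation ε (ζ + ω) ψ := by
  have h_shift := (measurePreserving_add_right (volume : Measure (Config d))
    ((2 * Real.pi * ε) • ζ.snd)).quasiMeasurePreserving
  refine Lp.ext ?_
  filter_upwards [coeFn_weylTranslation ε ζ (weylTranslation ε ω ψ),
    h_shift.ae (coeFn_weylTranslation ε ω ψ), coeFn_weylTranslation ε (ζ + ω) ψ,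
    Lp.coeFn_smul (𝐞 (Real.pi * ε * symplecticForm ζ ω) : ℂ) (weylTranslation ε (ζ + ω) ψ)]
    with q h_left h_right h_add h_smul
  rw [h_left, h_right, Circle.smul_def (𝐞 _) (weylTranslation _ _ _), h_smul, Pi.smul_apply, h_add,
    ← Circle.smul_def, smul_smul, smul_smul, weylPhase_mul_weylPhase, WithLp.add_snd, smul_add,
    add_assoc]

end Translation

section WaveSuperposition

theorem integrable_fourierChar_smul {V : Type*} [MeasurableSpace V] {μ : Measure V} {F : V → ℂ}
    {θ : V → ℝ} (hF : Integrable F μ) (hθ : Measurable θ) :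
    Integrable (fun v => 𝐞 (θ v) • F v) μ :=
  hF.mono ((Real.continuous_fourierChar.comp_aestronglyMeasurable
    hθ.aestronglyMeasurable).smul hF.aestronglyMeasurable)
    (.of_forall fun v => (Circle.norm_smul (𝐞 (θ v)) (F v)).le)

theorem integrable_mul_comp_sub {V E : Type*} [MeasurableSpace V] {μ : Measure V} [SFinite μ]
    [AddGroup E] [MeasurableSpace E] [MeasurableAdd₂ E] [MeasurableNeg E] {ν : Measure E}
    [SFinite ν] [ν.IsAddRightInvariant] {F : V → ℂ} {g : E → ℂ} {s : V → E}
    (hF : Integrable F μ) (hg : Integrable g ν) (hs : Measurable s) :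
    Integrable (fun x : V × E => F x.1 * g (x.2 - s x.1)) (μ.prod ν) := by
  have h_shear : MeasurePreserving (fun x : V × E => (x.1, x.2 - s x.1)) (μ.prod ν) (μ.prod ν) :=
    (MeasurePreserving.id μ).skew_product (by fun_prop)
      (.of_forall fun v => (measurePreserving_sub_right ν (s v)).map_eq)
  exact h_shear.integrable_comp_of_integrable (hF.mul_prod hg)

variable {E V : Type*} [NormedAddCommGroup E] [InnerProductSpace ℝ E] [MeasurableSpace E]
  [MeasurableSpace V]

/-- The function `c` is the superposition `c(z) = ∫ F(v) e^{2πi z·L(v)} dμ(v)` of plane waves, with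
integrable amplitudes `F v` and frequencies `L v`. -/
structure IsWaveSuperposition (μ : Measure V) (L : V → E) (F : V → ℂ) (c : E → ℂ) : Prop where
  measurable : Measurable L
  integrable : Integrable F μ
  eq_integral : ∀ z, c z = ∫ v, 𝐞 ⟪z, L v⟫_ℝ • F v ∂μ

namespace IsWaveSuperposition

variable {μ : Measure V} {L : V → E} {F F' : V → ℂ} {c c' : E → ℂ}

theorem smul (r : ℂ) (h : IsWaveSuperposition μ L F c) :
    IsWaveSuperposition μ L (r • F) (r • c) where
  measurable := h.measurable
  integrable := h.integrable.smul r
  eq_integral z := by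
    simp only [Pi.smul_apply, h.eq_integral, smul_comm _ r, integral_smul]

section Linear

variable [BorelSpace E] [SecondCountableTopology E]

theorem add (h : IsWaveSuperposition μ L F c) (h' : IsWaveSuperposition μ L F' c') :
    IsWaveSuperposition μ L (F + F') (c + c') where
  measurable := h.measurable
  integrable := h.integrable.add h'.integrable
  eq_integral z := by
    have h_meas : Measurable fun v => ⟪z, L v⟫_ℝ := measurable_const.inner h.measurable
    simp only [Pi.add_apply, smul_add, h.eq_integral, h'.eq_integral]
    exact (integral_add (integrable_fourierChar_smul h.integrable h_meas)
      (integrable_fourierChar_smul h'.integrable h_meas)).symm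

theorem sub (h : IsWaveSuperposition μ L F c) (h' : IsWaveSuperposition μ L F' c') :
    IsWaveSuperposition μ L (F - F') (c - c') := by
  simpa only [neg_one_smul, ← sub_eq_add_neg] using h.add (h'.smul (-1))

theorem sum {ι : Type*} {s : Finset ι} {F : ι → V → ℂ} {c : ι → E → ℂ} (hL : Measurable L)
    (h : ∀ i ∈ s, IsWaveSuperposition μ L (F i) (c i)) :
    IsWaveSuperposition μ L (∑ i ∈ s, F i) (∑ i ∈ s, c i) := by
  classical
  induction s using Finset.induction_on with
  | empty => exact ⟨hL, integrable_zero _ _ _, fun z => by simp⟩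
  | insert i s hi ih =>
    rw [Finset.sum_insert hi, Finset.sum_insert hi]
    exact (h i (s.mem_insert_self i)).add (ih fun j hj => h j (Finset.mem_insert_of_mem hj))

end Linear

end IsWaveSuperposition

variable [FiniteDimensional ℝ E] [BorelSpace E]

theorem isWaveSuperposition_fourier (c : 𝓢(E, ℂ)) :
    IsWaveSuperposition volume id (𝓕 c : 𝓢(E, ℂ)) c where
  measurable := measurable_id
  integrable := (𝓕 c).integrable
  eq_integral z := by
    conv_lhs => rw [← FourierTransform.fourierInv_fourier_eq (F := 𝓢(E, ℂ)) c]
    rw [SchwartzMap.fourierInv_coe, Real.fourierInv_eq]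
    simp only [real_inner_comm z, id_eq]

end WaveSuperposition

section Weyl

variable {d : ℕ} {V : Type*} [MeasurableSpace V] {μ : Measure V} {L : V → Phase d} {F : V → ℂ}
  {c : 𝓢(Phase d, ℂ)}

theorem exists_norm_le_one_add_norm_snd_pow (c : 𝓢(Phase d, ℂ)) (k : ℕ) :
    ∃ C, ∀ z : Phase d, ‖c z‖ ≤ C * (1 + ‖z.snd‖) ^ (-(k : ℝ)) := by
  refine ⟨2 ^ k * ((Finset.Iic (k, 0)).sup fun m => SchwartzMap.seminorm ℂ m.1 m.2) c, fun z => ?_⟩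
  have h_snd : ‖z.snd‖ ≤ ‖z‖ := WithLp.norm_snd_le _ z
  have h_decay := SchwartzMap.one_add_le_sup_seminorm_apply (𝕜 := ℂ) (m := (k, 0)) le_rfl le_rfl c z
  rw [norm_iteratedFDeriv_zero] at h_decay
  rw [Real.rpow_neg (by positivity), Real.rpow_natCast, ← div_eq_mul_inv,
    le_div_iff₀' (by positivity)]
  exact le_trans (by gcongr) h_decay

theorem inner_pt (q p : Config d) (z : Phase d) :
    ⟪pt q p, z⟫_ℝ = ⟪q, z.fst⟫_ℝ + ⟪p, z.snd⟫_ℝ :=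
  WithLp.prod_inner_apply _ _

theorem integrable_symbol_mul (c : 𝓢(Phase d, ℂ)) {x : Config d → Config d} (hx : Continuous x)
    {g : Config d → ℂ} (hg : Integrable g) :
    Integrable (fun y : Config d × Config d => c (pt (x y.1) y.2) * g y.1)
      (volume.prod volume) := by
  obtain ⟨C, hC⟩ := exists_norm_le_one_add_norm_snd_pow c (d + 1)
  have h_weight : Integrable fun p : Config d => C * (1 + ‖p‖) ^ (-((d + 1 : ℕ) : ℝ)) :=
    (integrable_one_add_norm (by simp)).const_mul C
  refine (hg.norm.mul_prod h_weight).mono'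
    (Continuous.aestronglyMeasurable ?_ |>.mul hg.aestronglyMeasurable.comp_fst)
    (.of_forall fun y => ?_)
  · fun_prop
  · rw [norm_mul, mul_comm]
    gcongr
    exact hC _

theorem weylFun_eq_integral_shift {ε : ℝ} (hε : 0 < ε) (c : 𝓢(Phase d, ℂ)) (φ : Config d → ℂ)
    (q : Config d) :
    weylFun ε c φ q = ∫ u : Config d, ∫ p : Config d,
      c (pt (q + (Real.pi * ε) • u) p) *
        (𝐞 (-⟪u, p⟫_ℝ) • φ (q + (2 * Real.pi * ε) • u)) := by
  set κ := 2 * Real.pi * ε with hκ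
  have hκ_pos : 0 < κ := by positivity
  let kernel (y p : Config d) : ℂ := c (pt ((2 : ℝ)⁻¹ • (q + y)) p) *
    Complex.exp (Complex.I * ((⟪q - y, p⟫_ℝ / ε : ℝ) : ℂ)) * φ y
  have h_scale := Measure.integral_comp_smul (volume : Measure (Config d))
    (fun u => ∫ p, kernel (q + u) p) κ
  have h_translate := integral_add_left_eq_self (μ := volume) (fun y => ∫ p, kernel y p) q
  have h_kernel (u p : Config d) : kernel (q + κ • u) p =
      c (pt (q + (Real.pi * ε) • u) p) * (𝐞 (-⟪u, p⟫_ℝ) • φ (q + κ • u)) := by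
    have h_mid : (2 : ℝ)⁻¹ • (q + (q + κ • u)) = q + (Real.pi * ε) • u := by
      rw [hκ]
      module
    have h_phase : ⟪q - (q + κ • u), p⟫_ℝ / ε = 2 * Real.pi * -⟪u, p⟫_ℝ := by
      rw [sub_add_cancel_left, inner_neg_left, real_inner_smul_left, hκ]
      field_simp
    simp only [kernel]
    rw [h_mid, h_phase, Circle.smul_def, Real.fourierChar_apply, mul_assoc, smul_eq_mul,
      mul_comm Complex.I]
  simp only [h_kernel] at h_scale
  rw [h_scale, h_translate, finrank_euclideanSpace_fin,
    abs_of_pos (inv_pos.2 (pow_pos hκ_pos d)), Complex.real_smul, weylFun]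

theorem weylFun_congr_ae (ε : ℝ) (c : 𝓢(Phase d, ℂ)) {ψ φ : Config d → ℂ} (h : ψ =ᵐ[volume] φ) :
    weylFun ε c ψ = weylFun ε c φ := by
  funext q
  rw [weylFun_eq, weylFun_eq]
  refine congrArg _ (integral_congr_ae ?_)
  filter_upwards [h] with y hy
  rw [hy]

theorem opWe_toLp_ae {ε : ℝ} (hε : 0 < ε) (c : 𝓢(Phase d, ℂ)) (φ : 𝓢(Config d, ℂ)) :
    opWe ε hε c (φ.toLp 2 volume) =ᵐ[volume] weylFun ε c φ :=
  weylFun_congr_ae ε c (φ.coeFn_toLp 2 volume) ▸ opWe_coeFn ε hε c _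

theorem weylTranslation_toLp_ae (ε : ℝ) (ζ : Phase d) (φ : 𝓢(Config d, ℂ)) :
    weylTranslation ε ζ (φ.toLp 2 volume) =ᵐ[volume]
      fun q => weylPhase ε ζ q • φ (q + (2 * Real.pi * ε) • ζ.snd) := by
  have h_shift := (measurePreserving_add_right (volume : Measure (Config d))
    ((2 * Real.pi * ε) • ζ.snd)).quasiMeasurePreserving
  filter_upwards [coeFn_weylTranslation ε ζ (φ.toLp 2 volume),
    h_shift.ae (φ.coeFn_toLp 2 volume)] with q h_trans h_φ
  rw [h_trans, h_φ]

theorem norm_integral_weylTranslation_le (F : V → ℂ) (L : V → Phase d) (ε : ℝ) (ψ : L2 d) :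
    ‖∫ v, F v • weylTranslation ε (L v) ψ ∂μ‖ ≤ (∫ v, ‖F v‖ ∂μ) * ‖ψ‖ := by
  refine (norm_integral_le_integral_norm _).trans_eq ?_
  simp only [norm_smul, LinearIsometry.norm_map, integral_mul_const]

namespace IsWaveSuperposition

theorem integrable_weylTranslation (h : IsWaveSuperposition μ L F c) (ε : ℝ) (ψ : L2 d) :
    Integrable (fun v => F v • weylTranslation ε (L v) ψ) μ :=
  h.integrable.smul_bdd ‖ψ‖
    ((continuous_weylTranslation ε ψ).stronglyMeasurable.comp_measurable
      h.measurable).aestronglyMeasurable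
    (.of_forall fun v => ((weylTranslation ε (L v)).norm_map ψ).le)

theorem continuous_integral_weylTranslation (h : IsWaveSuperposition μ L F c) (ε : ℝ) :
    Continuous fun ψ : L2 d => ∫ v, F v • weylTranslation ε (L v) ψ ∂μ := by
  let superposition : L2 d →ₗ[ℂ] L2 d :=
    { toFun ψ := ∫ v, F v • weylTranslation ε (L v) ψ ∂μ
      map_add' ψ φ := by
        simp only [map_add, smul_add]
        exact integral_add (h.integrable_weylTranslation ε ψ) (h.integrable_weylTranslation ε φ)
      map_smul' r ψ := by
        simp only [map_smul, smul_comm _ r, integral_smul, RingHom.id_apply] }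
  exact AddMonoidHomClass.continuous_of_bound superposition _
    (norm_integral_weylTranslation_le F L ε)

theorem integrable_conj_mul_weylPhase_smul (h : IsWaveSuperposition μ L F c) (ε : ℝ)
    (χ φ : 𝓢(Config d, ℂ)) :
    Integrable (fun y : Config d × V => starRingEnd ℂ (χ y.1) *
      (F y.2 * (weylPhase ε (L y.2) y.1 • φ (y.1 + (2 * Real.pi * ε) • (L y.2).snd))))
      (volume.prod μ) := by
  have hL := h.measurable
  obtain ⟨C, hC⟩ : ∃ C, ∀ x, ‖φ x‖ ≤ C :=
    ⟨_, fun x => SchwartzMap.norm_le_seminorm ℝ φ x⟩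
  have h_prod : Integrable (fun y : Config d × V => starRingEnd ℂ (χ y.1) * F y.2)
      (volume.prod μ) := (Complex.conjLIE.integrable_comp_iff.2 χ.integrable).mul_prod h.integrable
  have h_bdd := h_prod.mul_bdd (c := C)
    (g := fun y => φ (y.1 + (2 * Real.pi * ε) • (L y.2).snd))
    (φ.continuous.measurable.comp (by fun_prop)).aestronglyMeasurable (.of_forall fun y => hC _)
  refine (integrable_fourierChar_smul h_bdd
    (θ := fun y => ⟪(L y.2).fst, y.1 + (Real.pi * ε) • (L y.2).snd⟫_ℝ)
    (by fun_prop)).congr (.of_forall fun y => ?_)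
  simp only [weylPhase, mul_smul_comm, mul_assoc]

variable [SFinite μ]

theorem integral_symbol_mul_fourierChar_smul (h : IsWaveSuperposition μ L F c)
    {g : Config d → ℂ} (hg : Integrable g) (τ : ℝ) (x p : Config d) :
    ∫ u, c (pt (x + τ • u) p) * (𝐞 (-⟪u, p⟫_ℝ) • g u) =
      ∫ v, F v * (𝐞 (⟪x, (L v).fst⟫_ℝ + ⟪p, (L v).snd⟫_ℝ) • 𝓕 g (p - τ • (L v).fst)) ∂μ := by
  have hL := h.measurable
  let phase (y : Config d × V) : ℝ :=
    ⟪pt (x + τ • y.1) p, L y.2⟫_ℝ - ⟪y.1, p⟫_ℝ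
  have h_int : Integrable (fun y : Config d × V => 𝐞 (phase y) • (g y.1 * F y.2))
      (volume.prod μ) :=
    integrable_fourierChar_smul (hg.mul_prod h.integrable) (by fun_prop)
  calc ∫ u, c (pt (x + τ • u) p) * (𝐞 (-⟪u, p⟫_ℝ) • g u)
      = ∫ u : Config d, ∫ v, 𝐞 (phase (u, v)) • (g u * F v) ∂μ := by
        refine integral_congr_ae (.of_forall fun u => ?_)
        simp only [h.eq_integral, ← integral_mul_const, phase, sub_eq_add_neg,
          AddChar.map_add_eq_mul, Circle.smul_def, Circle.coe_mul, smul_eq_mul]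
        refine integral_congr_ae (.of_forall fun v => ?_)
        ring
    _ = ∫ v, (∫ u : Config d, 𝐞 (phase (u, v)) • (g u * F v)) ∂μ := integral_integral_swap h_int
    _ = _ := by
        refine integral_congr_ae (.of_forall fun v => ?_)
        have h_phase (u : Config d) : phase (u, v) =
            (⟪x, (L v).fst⟫_ℝ + ⟪p, (L v).snd⟫_ℝ) + -⟪u, p - τ • (L v).fst⟫_ℝ := by
          simp only [phase, inner_pt, inner_add_left, inner_sub_right,
            real_inner_smul_left, real_inner_smul_right]
          ring
        simp only [Real.fourier_eq, ← integral_const_mul, h_phase,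
          AddChar.map_add_eq_mul, Circle.smul_def, Circle.coe_mul, smul_eq_mul]
        refine integral_congr_ae (.of_forall fun u => ?_)
        ring

theorem integral_integral_mul_fourier_sub (h : IsWaveSuperposition μ L F c)
    (g : 𝓢(Config d, ℂ)) (τ : ℝ) (x : Config d) :
    ∫ p, ∫ v, F v * (𝐞 (⟪x, (L v).fst⟫_ℝ + ⟪p, (L v).snd⟫_ℝ) • 𝓕 g (p - τ • (L v).fst)) ∂μ =
      ∫ v, F v * (𝐞 ⟪(L v).fst, x + τ • (L v).snd⟫_ℝ • g (L v).snd) ∂μ := by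
  have hL := h.measurable
  have h_int : Integrable (Function.uncurry fun v p =>
      F v * (𝐞 (⟪x, (L v).fst⟫_ℝ + ⟪p, (L v).snd⟫_ℝ) • 𝓕 g (p - τ • (L v).fst)))
      (μ.prod volume) := by
    simp only [Function.uncurry_def, mul_smul_comm]
    exact integrable_fourierChar_smul
      (integrable_mul_comp_sub (s := fun v => τ • (L v).fst) h.integrable (𝓕 g).integrable
        (by fun_prop)) (by fun_prop)
  rw [← integral_integral_swap h_int]
  refine integral_congr_ae (.of_forall fun v => ?_)
  dsimp only
  rw [integral_const_mul, ← integral_add_right_eq_self _ (τ • (L v).fst)]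
  have h_phase (k : Config d) : ⟪x, (L v).fst⟫_ℝ + ⟪k + τ • (L v).fst, (L v).snd⟫_ℝ =
      ⟪(L v).fst, x + τ • (L v).snd⟫_ℝ + ⟪k, (L v).snd⟫_ℝ := by
    simp only [inner_add_left, inner_add_right, real_inner_smul_left, real_inner_smul_right,
      real_inner_comm x]
    ring
  have h_inversion : g (L v).snd = ∫ k, 𝐞 ⟪k, (L v).snd⟫_ℝ • 𝓕 g k := by
    conv_lhs => rw [← FourierTransform.fourierInv_fourier_eq (F := 𝓢(Config d, ℂ)) g]
    rw [SchwartzMap.fourierInv_coe, Real.fourierInv_eq]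
  simp only [h_phase, add_sub_cancel_right, AddChar.map_add_eq_mul, mul_smul, h_inversion,
    Circle.smul_def, integral_smul]

theorem weylFun_eq_integral (h : IsWaveSuperposition μ L F c) {ε : ℝ} (hε : 0 < ε)
    (φ : 𝓢(Config d, ℂ)) (q : Config d) :
    weylFun ε c φ q =
      ∫ v, F v * (weylPhase ε (L v) q • φ (q + (2 * Real.pi * ε) • (L v).snd)) ∂μ := by
  have hκ : 2 * Real.pi * ε ≠ 0 := by positivity
  let g : 𝓢(Config d, ℂ) := SchwartzMap.compCLMOfContinuousLinearEquiv ℂ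
    (ContinuousLinearEquiv.smulLeft (Units.mk0 _ hκ)) (φ.compSubConstCLM ℂ (-q))
  have hg (u : Config d) : g u = φ (q + (2 * Real.pi * ε) • u) := by
    simp only [g, SchwartzMap.compCLMOfContinuousLinearEquiv_apply, Function.comp_apply,
      SchwartzMap.compSubConstCLM_apply, sub_neg_eq_add, add_comm q]
    rfl
  have h_swap : Integrable (fun y : Config d × Config d =>
      c (pt (q + (Real.pi * ε) • y.1) y.2) * (𝐞 (-⟪y.1, y.2⟫_ℝ) • g y.1))
      (volume.prod volume) := by
    simp only [mul_smul_comm]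
    exact integrable_fourierChar_smul
      (integrable_symbol_mul c (x := fun u => q + (Real.pi * ε) • u) (by fun_prop) g.integrable)
      (by fun_prop)
  simp only [weylFun_eq_integral_shift hε, ← hg]
  rw [integral_integral_swap h_swap]
  simp only [h.integral_symbol_mul_fourierChar_smul g.integrable]
  exact h.integral_integral_mul_fourier_sub g _ q

theorem inner_opWe_toLp (h : IsWaveSuperposition μ L F c) {ε : ℝ} (hε : 0 < ε)
    (χ φ : 𝓢(Config d, ℂ)) :
    ⟪χ.toLp 2 volume, opWe ε hε c (φ.toLp 2 volume)⟫_ℂ =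
      ∫ v, F v * ⟪χ.toLp 2 volume, weylTranslation ε (L v) (φ.toLp 2 volume)⟫_ℂ ∂μ := by
  have h_weyl : ⟪χ.toLp 2 volume, opWe ε hε c (φ.toLp 2 volume)⟫_ℂ =
      ∫ q, starRingEnd ℂ (χ q) * weylFun ε c φ q := by
    rw [L2.inner_def]
    refine integral_congr_ae ?_
    filter_upwards [opWe_toLp_ae hε c φ, χ.coeFn_toLp 2 volume] with q h_opWe h_χ
    rw [h_opWe, h_χ, RCLike.inner_apply, mul_comm]
  have h_translation (v : V) : ⟪χ.toLp 2 volume, weylTranslation ε (L v) (φ.toLp 2 volume)⟫_ℂ =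
      ∫ q, starRingEnd ℂ (χ q) *
        (weylPhase ε (L v) q • φ (q + (2 * Real.pi * ε) • (L v).snd)) := by
    rw [L2.inner_def]
    refine integral_congr_ae ?_
    filter_upwards [weylTranslation_toLp_ae ε (L v) φ, χ.coeFn_toLp 2 volume]
      with q h_trans h_χ
    rw [h_trans, h_χ, RCLike.inner_apply, mul_comm]
  simp only [h_weyl, h_translation, h.weylFun_eq_integral hε, ← integral_const_mul]
  rw [integral_integral_swap (h.integrable_conj_mul_weylPhase_smul ε χ φ)]
  simp only [mul_left_comm]

theorem opWe_toLp (h : IsWaveSuperposition μ L F c) {ε : ℝ} (hε : 0 < ε) (φ : 𝓢(Config d, ℂ)) :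
    opWe ε hε c (φ.toLp 2 volume) =
      ∫ v, F v • weylTranslation ε (L v) (φ.toLp 2 volume) ∂μ := by
  refine (SchwartzMap.denseRange_toLpCLM (p := 2) ENNReal.ofNat_ne_top).eq_of_inner_right ℂ
    fun χ => ?_
  rw [SchwartzMap.toLpCLM_apply, h.inner_opWe_toLp hε,
    ← integral_inner (h.integrable_weylTranslation ε _)]
  simp only [inner_smul_right]

theorem opWe_apply (h : IsWaveSuperposition μ L F c) {ε : ℝ} (hε : 0 < ε) (ψ : L2 d) :
    opWe ε hε c ψ = ∫ v, F v • weylTranslation ε (L v) ψ ∂μ :=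
  congrFun ((SchwartzMap.denseRange_toLpCLM (p := 2) ENNReal.ofNat_ne_top).equalizer
    (opWe ε hε c).continuous (h.continuous_integral_weylTranslation ε)
    (funext (h.opWe_toLp hε))) ψ

theorem norm_opWe_le (h : IsWaveSuperposition μ L F c) {ε : ℝ} (hε : 0 < ε) :
    ‖opWe ε hε c‖ ≤ ∫ v, ‖F v‖ ∂μ :=
  (opWe ε hε c).opNorm_le_bound (by positivity) fun ψ =>
    h.opWe_apply hε ψ ▸ norm_integral_weylTranslation_le F L ε ψ

theorem opWe_comp {W : Type*} [MeasurableSpace W] {ν : Measure W} [SFinite ν] {M : W → Phase d}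
    {G : W → ℂ} {b m : 𝓢(Phase d, ℂ)} {ε : ℝ} (hε : 0 < ε) (h : IsWaveSuperposition μ L F c)
    (h' : IsWaveSuperposition ν M G b)
    (h_moyal : IsWaveSuperposition (μ.prod ν) (fun v => L v.1 + M v.2)
      (fun v => 𝐞 (Real.pi * ε * symplecticForm (L v.1) (M v.2)) • (F v.1 * G v.2)) m) :
    opWe ε hε c ∘L opWe ε hε b = opWe ε hε m := by
  ext1 ψ
  calc opWe ε hε c (opWe ε hε b ψ)
      = ∫ v, F v • weylTranslation ε (L v) (∫ w, G w • weylTranslation ε (M w) ψ ∂ν) ∂μ := by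
        rw [h.opWe_apply, h'.opWe_apply]
    _ = ∫ v, ∫ w, (𝐞 (Real.pi * ε * symplecticForm (L v) (M w)) • (F v * G w)) •
          weylTranslation ε (L v + M w) ψ ∂ν ∂μ := by
        refine integral_congr_ae (.of_forall fun v => ?_)
        dsimp only
        rw [← LinearIsometry.coe_toContinuousLinearMap, ← ContinuousLinearMap.integral_comp_comm _
          (h'.integrable_weylTranslation ε ψ), ← integral_smul]
        refine integral_congr_ae (.of_forall fun w => ?_)
        simp only [LinearIsometry.coe_toContinuousLinearMap, map_smul,
          weylTranslation_weylTranslation, Circle.smul_def, smul_smul, smul_eq_mul]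
        ring_nf
    _ = opWe ε hε m ψ := by
        rw [h_moyal.opWe_apply, integral_prod _ (h_moyal.integrable_weylTranslation ε ψ)]

end IsWaveSuperposition

theorem opWe_add {ε : ℝ} (hε : 0 < ε) (a b : 𝓢(Phase d, ℂ)) :
    opWe ε hε (a + b) = opWe ε hε a + opWe ε hε b := by
  have ha := isWaveSuperposition_fourier a
  have hb := isWaveSuperposition_fourier b
  have h_add : IsWaveSuperposition volume id
      ((𝓕 a : 𝓢(Phase d, ℂ)) + (𝓕 b : 𝓢(Phase d, ℂ)) : Phase d → ℂ) ⇑(a + b) := ha.add hb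
  ext1 ψ
  rw [add_apply, h_add.opWe_apply, ha.opWe_apply, hb.opWe_apply,
    ← integral_add (ha.integrable_weylTranslation ε ψ) (hb.integrable_weylTranslation ε ψ)]
  simp only [Pi.add_apply, add_smul]

theorem opWe_smul {ε : ℝ} (hε : 0 < ε) (r : ℂ) (a : 𝓢(Phase d, ℂ)) :
    opWe ε hε (r • a) = r • opWe ε hε a := by
  have ha := isWaveSuperposition_fourier a
  have h_smul : IsWaveSuperposition volume id
      (r • (𝓕 a : 𝓢(Phase d, ℂ)) : Phase d → ℂ) ⇑(r • a) := ha.smul r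
  ext1 ψ
  rw [smul_apply, h_smul.opWe_apply, ha.opWe_apply, ← integral_smul]
  simp only [Pi.smul_apply, smul_assoc]

end Weyl

section Exponential

theorem hasDerivAt_cexp_ofReal_mul (w : ℂ) (t : ℝ) :
    HasDerivAt (fun t : ℝ => Complex.exp (t * w)) (w * Complex.exp (t * w)) t := by
  simpa only [mul_comm w, Complex.ofRealCLM_apply, Complex.ofReal_one, one_mul] using!
    ((Complex.ofRealCLM.hasDerivAt (x := t)).mul_const w).cexp

theorem contDiff_cexp_ofReal_mul (w : ℂ) {n : WithTop ℕ∞} :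
    ContDiff ℝ n fun t : ℝ => Complex.exp (t * w) :=
  (Complex.ofRealCLM.contDiff.mul contDiff_const).cexp

theorem iteratedDeriv_cexp_ofReal_mul (w : ℂ) (n : ℕ) :
    iteratedDeriv n (fun t : ℝ => Complex.exp (t * w)) =
      fun t : ℝ => w ^ n * Complex.exp (t * w) := by
  induction n with
  | zero => simp only [iteratedDeriv_zero, pow_zero, one_mul]
  | succ n ih =>
    funext t
    rw [iteratedDeriv_succ, ih, ((hasDerivAt_cexp_ofReal_mul w t).const_mul (w ^ n)).deriv,
      pow_succ, mul_assoc]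

theorem hasTemperateGrowth_fourierChar :
    Function.HasTemperateGrowth fun t : ℝ => (𝐞 t : ℂ) := by
  have h_eq : (fun t : ℝ => (𝐞 t : ℂ)) =
      fun t : ℝ => Complex.exp (t * (2 * Real.pi * Complex.I)) := by
    funext t
    rw [Real.fourierChar_apply]
    push_cast
    ring_nf
  refine ⟨h_eq ▸ contDiff_cexp_ofReal_mul _, fun n => ⟨0, (2 * Real.pi) ^ n, fun t => ?_⟩⟩
  rw [norm_iteratedFDeriv_eq_norm_iteratedDeriv, h_eq, iteratedDeriv_cexp_ofReal_mul, norm_mul,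
    ← congrFun h_eq t, Circle.norm_coe]
  simp [abs_of_pos Real.pi_pos]

theorem norm_exp_sub_sum_le_max (n : ℕ) (w : ℂ) :
    ‖Complex.exp w - ∑ m ∈ Finset.range (n + 1), w ^ m / (m.factorial : ℂ)‖ ≤
      ‖w‖ ^ (n + 1) * max 1 (Real.exp w.re) / n.factorial := by
  have h_deriv : ∀ m : ℕ, ∀ t ∈ Set.Icc (0 : ℝ) 1,
      iteratedDerivWithin m (fun t : ℝ => Complex.exp (t * w)) (Set.Icc 0 1) t =
        w ^ m * Complex.exp (t * w) := fun m t ht => by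
    rw [iteratedDerivWithin_eq_iteratedDeriv (uniqueDiffOn_Icc_zero_one)
      (contDiff_cexp_ofReal_mul w).contDiffAt ht, iteratedDeriv_cexp_ofReal_mul]
  have h_bound : ∀ t ∈ Set.Icc (0 : ℝ) 1,
      ‖iteratedDerivWithin (n + 1) (fun t : ℝ => Complex.exp (t * w)) (Set.Icc 0 1) t‖ ≤
        ‖w‖ ^ (n + 1) * max 1 (Real.exp w.re) := fun t ht => by
    rw [h_deriv _ t ht, norm_mul, norm_pow, Complex.norm_exp, Complex.re_ofReal_mul]
    gcongr
    rcases le_total w.re 0 with h_re | h_re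
    · exact le_max_of_le_left
        (Real.exp_le_one_iff.2 (mul_nonpos_of_nonneg_of_nonpos ht.1 h_re))
    · exact le_max_of_le_right (Real.exp_le_exp.2 (mul_le_of_le_one_left h_re ht.2))
  have h_taylor := taylor_mean_remainder_bound zero_le_one
    (contDiff_cexp_ofReal_mul w).contDiffOn (Set.right_mem_Icc.2 zero_le_one) h_bound
  simp only [taylor_within_apply, h_deriv _ 0 (Set.left_mem_Icc.2 zero_le_one), sub_zero, one_pow,
    mul_one, Complex.ofReal_one, one_mul, Complex.ofReal_zero, zero_mul, Complex.exp_zero,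
    Complex.real_smul, Complex.ofReal_inv, Complex.ofReal_natCast] at h_taylor
  simpa only [div_eq_inv_mul] using h_taylor

end Exponential

section DoubledPhaseSpace

variable {d : ℕ}

theorem measurePreserving_ofLp_phase :
    MeasurePreserving (WithLp.ofLp : WithLp 2 (Phase d × Phase d) → Phase d × Phase d) volume
      (volume.prod volume) :=
  WithLp.volume_preserving_ofLp (Phase d) (Phase d)

theorem integral_comp_ofLp (f : Phase d × Phase d → ℂ) :
    ∫ x : WithLp 2 (Phase d × Phase d), f x.ofLp = ∫ x, f x ∂(volume.prod volume) :=
  measurePreserving_ofLp_phase.integral_comp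
    (MeasurableEquiv.toLp 2 (Phase d × Phase d)).symm.measurableEmbedding f

/-- A Schwartz function on `Phase d × Phase d`, which carries the sup norm, seen as a function on
the Euclidean product, where Mathlib's Fourier transform is available. -/
def onWithLp : 𝓢(Phase d × Phase d, ℂ) →L[ℂ] 𝓢(WithLp 2 (Phase d × Phase d), ℂ) :=
  SchwartzMap.compCLMOfContinuousLinearEquiv ℂ
    (WithLp.prodContinuousLinearEquiv 2 ℝ (Phase d) (Phase d))

theorem onWithLp_lineDeriv (u : Phase d × Phase d) (G : 𝓢(Phase d × Phase d, ℂ)) :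
    onWithLp (∂_{u} G) = ∂_{WithLp.toLp 2 u} (onWithLp G) :=
  (SchwartzMap.lineDerivOp_compCLMOfContinuousLinearEquiv ℂ (WithLp.toLp 2 u)
    (WithLp.prodContinuousLinearEquiv 2 ℝ (Phase d) (Phase d)) G).symm

/-- The Fourier transform of Schwartz functions on `Phase d × Phase d`. -/
def prodFourier : 𝓢(Phase d × Phase d, ℂ) →L[ℂ] 𝓢(Phase d × Phase d, ℂ) :=
  SchwartzMap.compCLMOfContinuousLinearEquiv ℂ
    (WithLp.prodContinuousLinearEquiv 2 ℝ (Phase d) (Phase d)).symm ∘L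
      FourierTransform.fourierCLM ℂ 𝓢(WithLp 2 (Phase d × Phase d), ℂ) ∘L onWithLp

theorem prodFourier_ofLp (G : 𝓢(Phase d × Phase d, ℂ)) (v : WithLp 2 (Phase d × Phase d)) :
    prodFourier G v.ofLp = 𝓕 (onWithLp G) v := rfl

theorem prodFourier_surjective : Function.Surjective (prodFourier (d := d)) := fun Φ => by
  refine ⟨SchwartzMap.compCLMOfContinuousLinearEquiv ℂ
    (WithLp.prodContinuousLinearEquiv 2 ℝ (Phase d) (Phase d)).symm (𝓕⁻ (onWithLp Φ)),
    SchwartzMap.ext fun v => ?_⟩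
  exact DFunLike.congr_fun (FourierTransform.fourier_fourierInv_eq
    (F := 𝓢(WithLp 2 (Phase d × Phase d), ℂ)) (onWithLp Φ)) (WithLp.toLp 2 v)

theorem prodFourier_tensor (a b : 𝓢(Phase d, ℂ)) :
    prodFourier (tensor a b) = tensor (𝓕 a) (𝓕 b) := by
  ext v
  change 𝓕 (fun x : WithLp 2 (Phase d × Phase d) => a x.ofLp.1 * b x.ofLp.2) (WithLp.toLp 2 v) =
    𝓕 (⇑a) v.1 * 𝓕 (⇑b) v.2
  simp only [Real.fourier_eq]
  rw [← integral_prod_mul, ← integral_comp_ofLp]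
  congr 1
  funext x
  rw [WithLp.prod_inner_apply, neg_add, AddChar.map_add_eq_mul]
  simp only [Circle.smul_def, Circle.coe_mul, smul_eq_mul]
  ring

theorem prodFourier_lineDeriv (u : Phase d × Phase d) (G : 𝓢(Phase d × Phase d, ℂ))
    (v : Phase d × Phase d) :
    prodFourier (∂_{u} G) v =
      2 * Real.pi * Complex.I * (⟪v.1, u.1⟫_ℝ + ⟪v.2, u.2⟫_ℝ : ℝ) * prodFourier G v := by
  rw [← WithLp.ofLp_toLp 2 v, prodFourier_ofLp, prodFourier_ofLp, onWithLp_lineDeriv,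
    SchwartzMap.fourier_lineDerivOp_eq, smul_apply,
    SchwartzMap.smulLeftCLM_apply_apply (by fun_prop), WithLp.prod_inner_apply, smul_eq_mul,
    Complex.real_smul, ← mul_assoc]

theorem isWaveSuperposition_diag (G : 𝓢(Phase d × Phase d, ℂ)) :
    IsWaveSuperposition (volume.prod volume) (fun v : Phase d × Phase d => v.1 + v.2)
      (prodFourier G) (diag G) where
  measurable := by fun_prop
  integrable := by
    rw [← measurePreserving_ofLp_phase.integrable_comp_emb
      (MeasurableEquiv.toLp 2 (Phase d × Phase d)).symm.measurableEmbedding]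
    exact (𝓕 (onWithLp G)).integrable
  eq_integral z := by
    have h_inv := (isWaveSuperposition_fourier (onWithLp G)).eq_integral (WithLp.toLp 2 (z, z))
    rw [← integral_comp_ofLp]
    simp only [inner_add_right]
    exact h_inv

theorem hasTemperateGrowth_symplecticForm :
    Function.HasTemperateGrowth fun v : Phase d × Phase d => symplecticForm v.1 v.2 :=
  ((innerSL ℝ).bilinear_hasTemperateGrowth
    (WithLp.sndL 2 ℝ (Config d) (Config d) ∘L
      ContinuousLinearMap.fst ℝ (Phase d) (Phase d)).hasTemperateGrowth
    (WithLp.fstL 2 ℝ (Config d) (Config d) ∘L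
      ContinuousLinearMap.snd ℝ (Phase d) (Phase d)).hasTemperateGrowth).sub
    ((innerSL ℝ).bilinear_hasTemperateGrowth
      (WithLp.fstL 2 ℝ (Config d) (Config d) ∘L
        ContinuousLinearMap.fst ℝ (Phase d) (Phase d)).hasTemperateGrowth
      (WithLp.sndL 2 ℝ (Config d) (Config d) ∘L
        ContinuousLinearMap.snd ℝ (Phase d) (Phase d)).hasTemperateGrowth)

theorem exists_opWe_comp_eq {ε : ℝ} (hε : 0 < ε) (a b : 𝓢(Phase d, ℂ)) :
    ∃ c : 𝓢(Phase d, ℂ), opWe ε hε a ∘L opWe ε hε b = opWe ε hε c ∧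
      IsWaveSuperposition (volume.prod volume) (fun v : Phase d × Phase d => v.1 + v.2)
        (fun v => 𝐞 (Real.pi * ε * symplecticForm v.1 v.2) • (tensor (𝓕 a) (𝓕 b)) v) c := by
  have h_growth : Function.HasTemperateGrowth fun v : Phase d × Phase d =>
      (𝐞 (Real.pi * ε * symplecticForm v.1 v.2) : ℂ) :=
    hasTemperateGrowth_fourierChar.comp
      ((Function.HasTemperateGrowth.const _).mul hasTemperateGrowth_symplecticForm)
  obtain ⟨G, hG⟩ := prodFourier_surjective (SchwartzMap.smulLeftCLM ℂ
    (fun v : Phase d × Phase d => (𝐞 (Real.pi * ε * symplecticForm v.1 v.2) : ℂ))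
    (tensor (𝓕 a) (𝓕 b)))
  have h_moyal := isWaveSuperposition_diag G
  rw [hG, funext (SchwartzMap.smulLeftCLM_apply_apply h_growth _)] at h_moyal
  exact ⟨diag G, (isWaveSuperposition_fourier a).opWe_comp hε (isWaveSuperposition_fourier b)
    h_moyal, h_moyal⟩

end DoubledPhaseSpace

namespace IsWaveSuperposition

theorem convolution {E V : Type*} [NormedAddCommGroup E] [InnerProductSpace ℝ E]
    [FiniteDimensional ℝ E] [MeasurableSpace E] [BorelSpace E] [MeasurableSpace V]
    {μ : Measure V} [SFinite μ] {L : V → E} {F : V → ℂ} {c : 𝓢(E, ℂ)}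
    (h : IsWaveSuperposition μ L F c) (g : 𝓢(E, ℂ)) :
    IsWaveSuperposition μ L (fun v => F v * 𝓕 g (L v))
      (SchwartzMap.convolution (ContinuousLinearMap.mul ℂ ℂ) c g) where
  measurable := h.measurable
  integrable := h.integrable.mul_bdd (g := fun v => 𝓕 g (L v))
    (c := SchwartzMap.seminorm ℝ 0 0 (𝓕 g))
    ((𝓕 g).continuous.measurable.comp h.measurable).aestronglyMeasurable
    (.of_forall fun v => SchwartzMap.norm_le_seminorm ℝ (𝓕 g) (L v))
  eq_integral z := by
    have h_int : Integrable (Function.uncurry fun ζ v => 𝐞 ⟪ζ, L v⟫_ℝ • (g (z - ζ) * F v))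
        (volume.prod μ) :=
      integrable_fourierChar_smul (θ := fun x : E × V => ⟪x.1, L x.2⟫_ℝ)
        ((g.integrable.comp_sub_left z).mul_prod h.integrable)
        (measurable_fst.inner (h.measurable.comp measurable_snd))
    calc SchwartzMap.convolution (ContinuousLinearMap.mul ℂ ℂ) c g z
        = ∫ ζ, ∫ v, 𝐞 ⟪ζ, L v⟫_ℝ • (g (z - ζ) * F v) ∂μ := by
          simp only [SchwartzMap.convolution_apply, convolution_def, ContinuousLinearMap.mul_apply',
            h.eq_integral, ← integral_mul_const, smul_mul_assoc, mul_comm (F _)]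
      _ = ∫ v, (∫ ζ, 𝐞 ⟪ζ, L v⟫_ℝ • (g (z - ζ) * F v)) ∂μ := integral_integral_swap h_int
      _ = ∫ v, (∫ u, 𝐞 ⟪z - u, L v⟫_ℝ • (g u * F v)) ∂μ := by
          simp only [← integral_sub_left_eq_self
            (fun ζ => 𝐞 ⟪ζ, L _⟫_ℝ • (g (z - ζ) * F _)) volume z, sub_sub_cancel]
      _ = ∫ v, 𝐞 ⟪z, L v⟫_ℝ • (F v * 𝓕 g (L v)) ∂μ := by
          refine integral_congr_ae (.of_forall fun v => ?_)
          have h_phase (u : E) : 𝐞 ⟪z - u, L v⟫_ℝ = 𝐞 ⟪z, L v⟫_ℝ * 𝐞 (-⟪u, L v⟫_ℝ) := by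
            rw [← AddChar.map_add_eq_mul, inner_sub_left, sub_eq_add_neg]
          simp only [SchwartzMap.fourier_coe, Real.fourier_eq, h_phase, mul_smul, Circle.smul_def,
            smul_eq_mul, ← integral_const_mul]
          congr 1
          funext u
          ring

end IsWaveSuperposition

section Gaussian

variable {d : ℕ} {ε : ℝ}

/-- The Fourier transform `e^{-π²ε|ζ|²}` of the Gaussian `G_{ε/2}`. -/
def gaussianMultiplier (ε : ℝ) (ζ : Phase d) : ℝ :=
  Real.exp (-(Real.pi ^ 2 * ε * ‖ζ‖ ^ 2))

theorem fourier_gaussian (hε : 0 < ε) (ζ : Phase d) :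
    𝓕 (toComplex (gaussian d ε hε)) ζ = gaussianMultiplier ε ζ := by
  have h_coe : ⇑(toComplex (gaussian d ε hε)) = (((Real.pi * ε : ℝ) : ℂ) ^ d)⁻¹ •
      fun u : Phase d => Complex.exp (-((ε⁻¹ : ℝ) : ℂ) * (‖u‖ : ℂ) ^ 2) := by
    funext u
    change (((((Real.pi * ε) ^ d)⁻¹ * Real.exp (-‖u‖ ^ 2 / ε) : ℝ)) : ℂ) = _
    rw [Pi.smul_apply, smul_eq_mul]
    push_cast
    ring_nf
  have h_dim : (Module.finrank ℝ (Phase d) : ℂ) / 2 = d := by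
    rw [(WithLp.linearEquiv 2 ℝ (Config d × Config d)).finrank_eq, Module.finrank_prod,
      finrank_euclideanSpace_fin]
    push_cast
    ring
  have h_ne : ((Real.pi * ε : ℝ) : ℂ) ≠ 0 := by
    exact_mod_cast (mul_pos Real.pi_pos hε).ne'
  have h_smul (r : ℂ) (f : Phase d → ℂ) : 𝓕 (r • f) = r • 𝓕 f :=
    VectorFourier.fourierIntegral_const_smul _ _ _ _ _
  have h_fourier := fourier_gaussian_innerProductSpace (V := Phase d) (b := (ε⁻¹ : ℝ))
    (by simpa using hε) ζ
  rw [h_dim, Complex.cpow_natCast, Complex.ofReal_inv, div_inv_eq_mul, ← Complex.ofReal_mul]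
    at h_fourier
  rw [SchwartzMap.fourier_coe, h_coe, h_smul, Pi.smul_apply, Complex.ofReal_inv, h_fourier,
    smul_eq_mul, inv_mul_cancel_left₀ (pow_ne_zero d h_ne), gaussianMultiplier]
  push_cast
  rw [div_inv_eq_mul]
  ring_nf

theorem IsWaveSuperposition.gaussConv {V : Type*} [MeasurableSpace V]
    {μ : Measure V} [SFinite μ] {L : V → Phase d} {F : V → ℂ} {c : 𝓢(Phase d, ℂ)}
    (h : IsWaveSuperposition μ L F c) (hε : 0 < ε) :
    IsWaveSuperposition μ L (fun v => F v * gaussianMultiplier ε (L v)) (gaussConv ε hε c) := by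
  simpa only [fourier_gaussian] using! h.convolution (toComplex (gaussian d ε hε))

theorem fourier_gaussConv (hε : 0 < ε) (a : 𝓢(Phase d, ℂ)) (ζ : Phase d) :
    𝓕 (gaussConv ε hε a) ζ = 𝓕 a ζ * gaussianMultiplier ε ζ := by
  rw [AntiWick.gaussConv, SchwartzMap.fourier_convolution,
    SchwartzMap.pairing_apply_apply, fourier_gaussian]
  rfl

end Gaussian

section StarProduct

variable {d : ℕ}

/-- `-1/2` times the symbol of `(∇_z, ∇_w) + i (J∇_z, ∇_w)` under the Fourier transform, so that
`λ_m` acts on waves as multiplication by `starExponent ^ m / m!`. -/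
def starExponent (v : Phase d × Phase d) : ℂ :=
  2 * Real.pi ^ 2 * (⟪v.1, v.2⟫_ℝ + Complex.I * symplecticForm v.1 v.2)

theorem inner_dirQ (ζ : Phase d) (j : Fin d) : ⟪ζ, dirQ j⟫_ℝ = ζ.fst j := by
  rw [real_inner_comm, dirQ, inner_pt]
  simp [EuclideanSpace.inner_single_left]

theorem inner_dirP (ζ : Phase d) (j : Fin d) : ⟪ζ, dirP j⟫_ℝ = ζ.snd j := by
  rw [real_inner_comm, dirP, inner_pt]
  simp [EuclideanSpace.inner_single_left]

theorem inner_eq_sum_dir (ζ ω : Phase d) :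
    ⟪ζ, ω⟫_ℝ = ∑ j, (⟪ζ, dirQ j⟫_ℝ * ⟪ω, dirQ j⟫_ℝ + ⟪ζ, dirP j⟫_ℝ * ⟪ω, dirP j⟫_ℝ) := by
  simp only [inner_dirQ, inner_dirP, Finset.sum_add_distrib]
  rw [WithLp.prod_inner_apply, PiLp.inner_apply, PiLp.inner_apply]
  simp only [RCLike.inner_apply, conj_trivial, mul_comm]
  rfl

theorem symplecticForm_eq_sum_dir (ζ ω : Phase d) :
    symplecticForm ζ ω =
      ∑ j, (⟪ζ, dirP j⟫_ℝ * ⟪ω, dirQ j⟫_ℝ - ⟪ζ, dirQ j⟫_ℝ * ⟪ω, dirP j⟫_ℝ) := by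
  simp only [inner_dirQ, inner_dirP, Finset.sum_sub_distrib, symplecticForm, PiLp.inner_apply,
    RCLike.inner_apply, conj_trivial, mul_comm]

theorem prodFourier_dz_dw (u u' : Phase d) (G : 𝓢(Phase d × Phase d, ℂ)) (v : Phase d × Phase d) :
    prodFourier (dz u (dw u' G)) v =
      -4 * Real.pi ^ 2 * (⟪v.1, u⟫_ℝ * ⟪v.2, u'⟫_ℝ : ℝ) * prodFourier G v := by
  rw [dz, dw, LineDeriv.lineDerivOpCLM_apply, LineDeriv.lineDerivOpCLM_apply,
    prodFourier_lineDeriv, prodFourier_lineDeriv]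
  simp only [inner_zero_right, add_zero, zero_add]
  push_cast
  linear_combination (4 * (Real.pi : ℂ) ^ 2 * ⟪v.1, u⟫_ℝ * ⟪v.2, u'⟫_ℝ * prodFourier G v) *
    Complex.I_sq

theorem prodFourier_gradGrad (G : 𝓢(Phase d × Phase d, ℂ)) (v : Phase d × Phase d) :
    prodFourier (gradGrad d G) v = -4 * Real.pi ^ 2 * ⟪v.1, v.2⟫_ℝ * prodFourier G v := by
  rw [inner_eq_sum_dir]
  simp only [gradGrad, sum_apply, add_apply, ContinuousLinearMap.comp_apply, map_sum, map_add,
    prodFourier_dz_dw, Complex.ofReal_sum, Complex.ofReal_add,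
    Finset.mul_sum, Finset.sum_mul, mul_add, add_mul]

theorem prodFourier_symplGrad (G : 𝓢(Phase d × Phase d, ℂ)) (v : Phase d × Phase d) :
    prodFourier (symplGrad d G) v =
      -4 * Real.pi ^ 2 * symplecticForm v.1 v.2 * prodFourier G v := by
  simp only [symplGrad, sum_apply, sub_apply, ContinuousLinearMap.comp_apply, map_sum, map_sub,
    prodFourier_dz_dw, symplecticForm_eq_sum_dir, Complex.ofReal_sum, Complex.ofReal_sub,
    Finset.mul_sum, Finset.sum_mul, mul_sub, sub_mul]

theorem prodFourier_bidifferential_pow (m : ℕ) (G : 𝓢(Phase d × Phase d, ℂ))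
    (v : Phase d × Phase d) :
    prodFourier (((gradGrad d + Complex.I • symplGrad d) ^ m) G) v =
      (-2 * starExponent v) ^ m * prodFourier G v := by
  induction m with
  | zero => rw [pow_zero, pow_zero, one_mul, one_apply_eq_self]
  | succ m ih =>
    rw [pow_succ', mul_apply_eq_comp, add_apply, smul_apply, map_add, map_smul,
      add_apply, smul_apply, prodFourier_gradGrad, prodFourier_symplGrad,
      ih, starExponent, smul_eq_mul]
    ring

theorem isWaveSuperposition_lam (m : ℕ) (a b : 𝓢(Phase d, ℂ)) :
    IsWaveSuperposition (volume.prod volume) (fun v : Phase d × Phase d => v.1 + v.2)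
      (fun v => starExponent v ^ m / m.factorial * tensor (𝓕 a) (𝓕 b) v) (lam m a b) := by
  have h := (isWaveSuperposition_diag (((gradGrad d + Complex.I • symplGrad d) ^ m)
    (tensor a b))).smul ((-1) ^ m / (2 ^ m * m.factorial))
  convert! h using 1
  funext v
  have h_pow : starExponent v ^ m = (-1) ^ m / 2 ^ m * (-2 * starExponent v) ^ m := by
    rw [← div_pow, ← mul_pow]
    ring_nf
  rw [Pi.smul_apply, prodFourier_bidifferential_pow, prodFourier_tensor, smul_eq_mul, h_pow]
  ring

theorem lam_zero (a b : 𝓢(Phase d, ℂ)) : lam 0 a b = mulS a b := by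
  simp only [lam, pow_zero, Nat.factorial_zero, Nat.cast_one, mul_one, div_one, one_smul]
  rfl

theorem mulS_add_sum_Icc_lam (n : ℕ) (ε : ℂ) (a b : 𝓢(Phase d, ℂ)) :
    mulS a b + ∑ m ∈ Finset.Icc 1 n, ε ^ m • lam m a b =
      ∑ m ∈ Finset.range (n + 1), ε ^ m • lam m a b := by
  rw [Nat.range_succ_eq_Icc_zero, ← Finset.add_sum_Ioc_eq_sum_Icc n.zero_le, pow_zero, one_smul,
    lam_zero]
  rfl

theorem isWaveSuperposition_sum_lam (n : ℕ) (ε : ℝ) (a b : 𝓢(Phase d, ℂ)) :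
    IsWaveSuperposition (volume.prod volume) (fun v : Phase d × Phase d => v.1 + v.2)
      (fun v => (∑ m ∈ Finset.range (n + 1), (ε * starExponent v) ^ m / m.factorial) *
        tensor (𝓕 a) (𝓕 b) v)
      (mulS a b + ∑ m ∈ Finset.Icc 1 n, (ε : ℂ) ^ m • lam m a b : 𝓢(Phase d, ℂ)) := by
  rw [mulS_add_sum_Icc_lam]
  have h := IsWaveSuperposition.sum (s := Finset.range (n + 1)) (by fun_prop) fun m _ =>
    (isWaveSuperposition_lam m a b).smul ((ε : ℂ) ^ m)
  convert! h using 1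
  · funext v
    simp only [Finset.sum_apply, Finset.sum_mul, Pi.smul_apply, smul_eq_mul, mul_pow,
      mul_div_assoc, mul_assoc]
  · funext z
    simp only [sum_apply, Finset.sum_apply, smul_apply, Pi.smul_apply]

theorem gaussianMultiplier_mul_fourierChar (ε : ℝ) (v : Phase d × Phase d) :
    gaussianMultiplier ε v.1 * gaussianMultiplier ε v.2 *
        (𝐞 (Real.pi * ε * symplecticForm v.1 v.2) : ℂ) =
      gaussianMultiplier ε (v.1 + v.2) * Complex.exp (ε * starExponent v) := by
  simp only [gaussianMultiplier, norm_add_sq_real, starExponent, Real.fourierChar_apply,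
    Complex.ofReal_exp, ← Complex.exp_add]
  congr 1
  push_cast
  ring

theorem gaussianMultiplier_mul_max_le_one {ε : ℝ} (hε : 0 < ε) (v : Phase d × Phase d) :
    gaussianMultiplier ε (v.1 + v.2) * max 1 (Real.exp (ε * starExponent v).re) ≤ 1 := by
  have h_re : (ε * starExponent v).re = 2 * Real.pi ^ 2 * ε * ⟪v.1, v.2⟫_ℝ := by
    have h_eq : ε * starExponent v =
        (2 * Real.pi ^ 2 * ε * ⟪v.1, v.2⟫_ℝ : ℝ) +
          (2 * Real.pi ^ 2 * ε * symplecticForm v.1 v.2 : ℝ) * Complex.I := by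
      rw [starExponent]
      push_cast
      ring
    rw [h_eq, Complex.add_re, Complex.ofReal_re, Complex.re_ofReal_mul, Complex.I_re, mul_zero,
      add_zero]
  rw [h_re, gaussianMultiplier, mul_max_of_nonneg _ _ (Real.exp_pos _).le, mul_one,
    ← Real.exp_add]
  refine max_le (Real.exp_le_one_iff.2 ?_) (Real.exp_le_one_iff.2 ?_)
  · exact neg_nonpos.2 (by positivity)
  · have h_sq : 0 ≤ Real.pi ^ 2 * ε * (‖v.1‖ ^ 2 + ‖v.2‖ ^ 2) := by positivity
    rw [norm_add_sq_real]
    linarith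

/-- The Taylor remainder of order `n` of `e^{εθ}`, `θ = starExponent v`, damped by the Gaussian and
divided by `ε^{n+1}`: the amplitude of the remainder symbol relative to that of `a ⊗ b`. -/
def remainderMultiplier (n : ℕ) (ε : ℝ) (v : Phase d × Phase d) : ℂ :=
  ((ε : ℂ) ^ (n + 1))⁻¹ * (gaussianMultiplier ε (v.1 + v.2) *
    (Complex.exp (ε * starExponent v) -
      ∑ m ∈ Finset.range (n + 1), (ε * starExponent v) ^ m / m.factorial))

theorem norm_remainderMultiplier_le (n : ℕ) {ε : ℝ} (hε : 0 < ε) (v : Phase d × Phase d) :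
    ‖remainderMultiplier n ε v‖ ≤ ‖starExponent v ^ (n + 1) / n.factorial‖ := by
  set w := ε * starExponent v with hw
  set G := gaussianMultiplier ε (v.1 + v.2)
  have hG : 0 < G := Real.exp_pos _
  have h_norm : ‖w‖ = ε * ‖starExponent v‖ := by
    rw [hw, norm_mul, Complex.norm_real, Real.norm_of_nonneg hε.le]
  calc ‖remainderMultiplier n ε v‖
      = (ε ^ (n + 1))⁻¹ * (G * ‖Complex.exp w -
          ∑ m ∈ Finset.range (n + 1), w ^ m / m.factorial‖) := by
        rw [remainderMultiplier, norm_mul, norm_mul, norm_inv, norm_pow, Complex.norm_real,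
          Complex.norm_real, Real.norm_of_nonneg hε.le, Real.norm_of_nonneg hG.le]
    _ ≤ (ε ^ (n + 1))⁻¹ * (G * (‖w‖ ^ (n + 1) * max 1 (Real.exp w.re) / n.factorial)) := by
        gcongr
        exact norm_exp_sub_sum_le_max n w
    _ = ‖starExponent v‖ ^ (n + 1) / n.factorial * (G * max 1 (Real.exp w.re)) := by
        rw [h_norm, mul_pow]
        field_simp
    _ ≤ ‖starExponent v‖ ^ (n + 1) / n.factorial * 1 := by
        gcongr
        exact gaussianMultiplier_mul_max_le_one hε v
    _ = ‖starExponent v ^ (n + 1) / n.factorial‖ := by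
        rw [mul_one, norm_div, norm_pow, Complex.norm_natCast]

theorem exists_opAW_comp_eq (n : ℕ) {ε : ℝ} (hε : 0 < ε) (a b : 𝓢(Phase d, ℂ)) :
    ∃ γ : 𝓢(Phase d, ℂ),
      opAW ε hε a ∘L opAW ε hε b =
        opAW ε hε (mulS a b + ∑ m ∈ Finset.Icc 1 n, (ε : ℂ) ^ m • lam m a b) +
          (ε : ℂ) ^ (n + 1) • opWe ε hε γ ∧
      IsWaveSuperposition (volume.prod volume) (fun v : Phase d × Phase d => v.1 + v.2)
        (fun v => remainderMultiplier n ε v * tensor (𝓕 a) (𝓕 b) v) γ := by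
  have hε_ne : (ε : ℂ) ^ (n + 1) ≠ 0 := pow_ne_zero _ (by exact_mod_cast hε.ne')
  set S := mulS a b + ∑ m ∈ Finset.Icc 1 n, (ε : ℂ) ^ m • lam m a b
  obtain ⟨c, h_comp, hc⟩ := exists_opWe_comp_eq hε (gaussConv ε hε a) (gaussConv ε hε b)
  have hS := (isWaveSuperposition_sum_lam n ε a b).gaussConv hε
  refine ⟨((ε : ℂ) ^ (n + 1))⁻¹ • (c - gaussConv ε hε S), ?_, ?_⟩
  · rw [opAW, opAW, opAW, h_comp, ← opWe_smul, ← opWe_add, smul_inv_smul₀ hε_ne, add_sub_cancel]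
  · convert! (hc.sub hS).smul ((ε : ℂ) ^ (n + 1))⁻¹ using 1
    funext v
    have h_tensor : tensor (𝓕 (gaussConv ε hε a)) (𝓕 (gaussConv ε hε b)) v =
        gaussianMultiplier ε v.1 * gaussianMultiplier ε v.2 * tensor (𝓕 a) (𝓕 b) v := by
      change 𝓕 (gaussConv ε hε a) v.1 * 𝓕 (gaussConv ε hε b) v.2 = _ * (𝓕 a v.1 * 𝓕 b v.2)
      rw [fourier_gaussConv, fourier_gaussConv]
      ring
    simp only [Pi.smul_apply, Pi.sub_apply, h_tensor, remainderMultiplier, Circle.smul_def,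
      smul_eq_mul]
    linear_combination (-((ε : ℂ) ^ (n + 1))⁻¹ * tensor (𝓕 a) (𝓕 b) v) *
      gaussianMultiplier_mul_fourierChar ε v

theorem exists_norm_opWe_le_and_opAW_comp_eq (n : ℕ) {ε : ℝ} (hε : 0 < ε) (a b : 𝓢(Phase d, ℂ)) :
    ∃ γ : 𝓢(Phase d, ℂ),
      ‖opWe ε hε γ‖ ≤ ∫ v : Phase d × Phase d,
        ‖starExponent v ^ (n + 1) / n.factorial * tensor (𝓕 a) (𝓕 b) v‖ ∂(volume.prod volume) ∧
      opAW ε hε a ∘L opAW ε hε b =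
        opAW ε hε (mulS a b + ∑ m ∈ Finset.Icc 1 n, (ε : ℂ) ^ m • lam m a b) +
          (ε : ℂ) ^ (n + 1) • opWe ε hε γ := by
  obtain ⟨γ, h_comp, hγ⟩ := exists_opAW_comp_eq n hε a b
  have h_int : Integrable (fun v : Phase d × Phase d =>
      starExponent v ^ (n + 1) / n.factorial * tensor (𝓕 a) (𝓕 b) v) (volume.prod volume) := by
    refine ((isWaveSuperposition_lam (n + 1) a b).integrable.const_mul (n + 1)).congr
      (.of_forall fun v => ?_)
    dsimp only
    rw [Nat.factorial_succ]
    push_cast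
    have : (n + 1 : ℂ) ≠ 0 := by exact_mod_cast n.succ_ne_zero
    field_simp
  refine ⟨γ, (hγ.norm_opWe_le hε).trans (integral_mono hγ.integrable.norm h_int.norm fun v => ?_),
    h_comp⟩
  simp only [norm_mul]
  exact mul_le_mul_of_nonneg_right (norm_remainderMultiplier_le n hε v) (norm_nonneg _)

end StarProduct

end AntiWick

end

theorem mainTheorem9_general (d n : ℕ) (a b : 𝓢(AntiWick.Phase d, ℂ)) :
    ∃ γ : ℝ → 𝓢(AntiWick.Phase d, ℂ),
      (∃ C : ℝ, ∀ (ε : ℝ) (hε : 0 < ε), ‖AntiWick.opWe ε hε (γ ε)‖ ≤ C) ∧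
      ∀ (ε : ℝ) (hε : 0 < ε),
        AntiWick.opAW ε hε a ∘L AntiWick.opAW ε hε b =
          AntiWick.opAW ε hε (AntiWick.mulS a b +
              ∑ m ∈ Finset.Icc 1 n, ((ε : ℂ) ^ m) • AntiWick.lam m a b) +
            ((ε : ℂ) ^ (n + 1)) • AntiWick.opWe ε hε (γ ε) := by
  choose γ h_bound h_comp using
    fun (ε : ℝ) (hε : 0 < ε) => AntiWick.exists_norm_opWe_le_and_opAW_comp_eq n hε a b
  refine ⟨fun ε => if hε : 0 < ε then γ ε hε else 0,
    ⟨_, fun ε hε => le_of_eq_of_le ?_ (h_bound ε hε)⟩, fun ε hε => ?_⟩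
  · simp only [dif_pos hε]
  · simpa only [dif_pos hε] using h_comp ε hε

theorem mainTheorem9 (d n : ℕ)
    (a b : 𝓢(AntiWick.Phase d, ℝ)) :
    ∃ γ : ℝ → 𝓢(AntiWick.Phase d, ℂ),
      (∃ C : ℝ, ∀ (ε : ℝ) (hε : 0 < ε), ‖AntiWick.opWe ε hε (γ ε)‖ ≤ C) ∧
      ∀ (ε : ℝ) (hε : 0 < ε),
        AntiWick.opAW ε hε (AntiWick.toComplex a) ∘L AntiWick.opAW ε hε (AntiWick.toComplex b) =
          AntiWick.opAW ε hε
            (AntiWick.mulS (AntiWick.toComplex a) (AntiWick.toComplex b) +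
              ∑ m ∈ Finset.Icc 1 n,
                ((ε : ℂ) ^ m) • AntiWick.lam m (AntiWick.toComplex a) (AntiWick.toComplex b)) +
          ((ε : ℂ) ^ (n + 1)) • AntiWick.opWe ε hε (γ ε) :=
  mainTheorem9_general d n (AntiWick.toComplex a) (AntiWick.toComplex b)
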